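/- **Setting.** Let $\mathbb X\subset\mathbb R$ be closed and unbounded above, $t_0\in\mathbb X$, with jump operators $\sigma(t)=\inf\{s\in\mathbb X:s>t\}$, $\rho(t)=\sup\{s\in\mathbb X:s<t\}$ ($\rho(t)=t$ if $t=\min\mathbb X$) satisfying the Sturmian condition $\sigma(\rho(t))=\rho(\sigma(t))=t$ for $t\in[t_0,\infty)_{\mathbb X}:=[t_0,\infty)\cap\mathbb X$. Put $\mu(t)=\sigma(t)-t$, $g^\sigma=g\circ\sigma$, let $g^\Delta$ be the delta derivative and $\int\cdots\Delta t$ the (Lebesgue) delta integral. Let $A=\begin{pmatrix}A_1&0\\0&A_2\end{pmatrix}\ge0$ and $B=\begin{pmatrix}B_1&B_2\\B_3&B_4\end{pmatrix}$ have rd-continuous $n\times n$ complex blocks on $[t_0,\infty)_{\mathbb X}$, with $I_n+\mu B_2$ and $I_n+\mu B_3$ invertible; $J=\begin{pmatrix}0&-I_n\\I_n&0\end{pmatrix}$, $E_2=(I_n+\mu B_2)^{-1}$. For $\lambda\in\mathbb C$ put $$H=\begin{pmatrix}I_n&0\\-\mu E_2(\lambda A_1+B_1)&E_2\end{pmatrix},\quad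 \widetilde H=\begin{pmatrix}E_2^*&-\mu E_2^*(\overline\lambda A_2+B_4^*)\\0&I_n\end{pmatrix},\quad N=\begin{pmatrix}0&0\\-\mu E_2&0\end{pmatrix}.$$ Let $\widehat Y=(\widehat\theta|\widehat\phi)$ and $\widehat Z$ be the $2n\times2n$ matrix solutions of $J\widehat Y^\Delta=(\lambda A+B)H\widehat Y$ and $J\widehat Z^\Delta=(\overline\lambda A+B^*)\widetilde H\widehat Z^\sigma$ on $[t_0,\infty)_{\mathbb X}$ with $\widehat Y(t_0)=\widehat Z(t_0)=J$, and put $(\theta|\phi)=H\widehat Y$, $(\eta|\chi)=\widetilde H\widehat Z^\sigma$ (all blocks $2n\times n$). For a matrix weight $G\ge0$ let $\|y\|_G^2=\int_{t_0}^\infty y^*Gy\,\Delta t$, and let $L^2_G$ be the space of measurable $\mathbb C^{2n}$-valued $y$ with $\|y\|_G<\infty$, where $x,y$ are identified if $\|x-y\|_G=0$. Let $\mathscr U\in\mathbb C^{n,n}$ be invertible, $\mathscr U_{2n}=\begin{pmatrix}\mathscr U&0\\0&-\mathscr U^*\end{pmatrix}$, $\operatorname{Re}K=\frac12(K+K^*)$,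 $\widetilde A=\mathscr U_{2n}A\,\mathscr U_{2n}^*$ and $W(t,\lambda)=\operatorname{Re}[\mathscr U_{2n}(\lambda A(t)+B(t))]$. Let $\lambda_0\in\mathbb C$ be such that $W(t,\lambda_0)\ge0$ for all $t\in[t_0,\infty)_{\mathbb X}$. Let $\Lambda$ be the set of $\lambda\in\mathbb C$ for which there is $\delta>0$ with $$\operatorname{Re}[(\lambda-\lambda_0)\mathscr U_{2n}A(t)]\ge\delta\,\mathscr U_{2n}A(t)\,\mathscr U_{2n}^*\quad\text{for all }t\in[t_0,\infty)_{\mathbb X},\qquad(1)$$ and $\widetilde\Lambda$ the set of $\lambda\in\mathbb C$ for which there is $\delta>0$ with $\operatorname{Re}[(\lambda-\lambda_0)A(t)\mathscr U_{2n}^{-1*}]\ge\delta\,\mathscr U_{2n}^{-1}A(t)\,\mathscr U_{2n}^{-1*}$ for all $t\in[t_0,\infty)_{\mathbb X}$. Let $D(t,\lambda)$ be the set of $l\in\mathbb C^{n,n}$ with $(\widehat\theta(t)+\widehat\phi(t)l)^*\mathscr U_{2n}J(\widehat\theta(t)+\widehat\phi(t)l)\le0$ and $D(\infty,\lambda)$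 the set of $l$ that lie in $D(t,\lambda)$ for all sufficiently large $t\in[t_0,\infty)_{\mathbb X}$. For $\lambda\in\Lambda\cap\widetilde\Lambda$ and $M\in D(\infty,\lambda)$ put $\psi=\theta+\phi M$, $\zeta=\eta+\chi M^*$, and $$(R_\lambda f)(t)=\psi(t)\int_{t_0}^t\chi^*Af\,\Delta s+\phi(t)\int_t^\infty\zeta^*Af\,\Delta s+N(t)A(t)f(t),\quad t\in[t_0,\infty)_{\mathbb X}.$$ **Theorem.** Let $\lambda\in\Lambda\cap\widetilde\Lambda$, $M\in D(\infty,\lambda)$, $f\in L^2_A$ and $\Phi=R_\lambda f$. Then the integrals defining $\Phi$ converge, $\Phi\in L^2_{W(\lambda_0)}\cap L^2_{\widetilde A}$, and for every $\delta>0$ satisfying (1), $$\|\Phi\|^2_{W(\lambda_0)}+(\delta-\varepsilon)\|\Phi\|^2_{\widetilde A}\le\frac1{4\varepsilon}\|f\|_A^2\quad\text{for all }0<\varepsilon<\delta,\qquad\text{and}\qquad\|\Phi\|_{\widetilde A}\le\frac1\delta\|f\|_A.$$ In particular, if $\widetilde A\asymp A$, i.e. $cA(t)\le\widetilde A(t)\le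 CA(t)$ for all $t\in[t_0,\infty)_{\mathbb X}$ with constants $c,C>0$, then $R_\lambda$ is a bounded linear operator on $L^2_A$. -/

import Mathlib

open MeasureTheory Set Filter Topology Matrix
open scoped ComplexOrder ENNReal NNReal

noncomputable section

namespace TimeScale

/-- Right jump operator `σ(t) = inf {s ∈ X : s > t}` (used for `X` unbounded above). -/
def sigma (X : Set ℝ) (t : ℝ) : ℝ := sInf {s | s ∈ X ∧ t < s}

open Classical in
/-- Left jump operator `ρ(t) = sup {s ∈ X : s < t}`, with the usual convention `sup ∅ = inf X`,
that is, `ρ(t) = t` when `t` is the least element of `X`. -/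
def rho (X : Set ℝ) (t : ℝ) : ℝ :=
  if ∃ s ∈ X, s < t then sSup {s | s ∈ X ∧ s < t} else t

/-- Graininess `μ(t) = σ(t) - t`. -/
def mu (X : Set ℝ) (t : ℝ) : ℝ := sigma X t - t

/-- The half-line `[t₀, ∞) ∩ X`. -/
def ray (X : Set ℝ) (t₀ : ℝ) : Set ℝ := X ∩ Ici t₀

/-- Rd-continuity on `[t₀, ∞) ∩ X`: continuity at right-dense points and existence of
(finite) left limits at left-dense points. -/
def RdContinuous {E : Type*} [TopologicalSpace E] (X : Set ℝ) (t₀ : ℝ) (g : ℝ → E) : Prop :=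
  ∀ t ∈ ray X t₀,
    (sigma X t = t → ContinuousWithinAt g (ray X t₀) t) ∧
    (rho X t = t → ∃ l : E, Tendsto g (𝓝[ray X t₀ ∩ Iio t] t) (𝓝 l))

/-- `d` is the delta derivative at `t` of the scalar function `g` on `[t₀, ∞) ∩ X`: for every
`ε > 0`, `|g(σ(t)) - g(s) - (σ(t) - s) d| ≤ ε |σ(t) - s|` for all `s ∈ [t₀, ∞) ∩ X` near `t`. -/
def HasDeltaDeriv (X : Set ℝ) (t₀ : ℝ) (g : ℝ → ℂ) (d : ℂ) (t : ℝ) : Prop :=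
  ∀ ε : ℝ, 0 < ε → ∀ᶠ s in 𝓝[ray X t₀] t,
    ‖g (sigma X t) - g s - ((sigma X t - s : ℝ) : ℂ) * d‖ ≤ ε * |sigma X t - s|

/-- Entrywise delta derivative of a matrix function. -/
def HasMatrixDeltaDeriv {m k : Type*} (X : Set ℝ) (t₀ : ℝ)
    (F : ℝ → Matrix m k ℂ) (D : Matrix m k ℂ) (t : ℝ) : Prop :=
  ∀ i j, HasDeltaDeriv X t₀ (fun s => F s i j) (D i j) t

/-- The Lebesgue delta measure on `[t₀, ∞) ∩ X` (for `t₀ ∈ X`, `X` closed), regarded as a measure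
on `ℝ`. It is the image of Lebesgue measure on `[t₀, ∞)` under `s ↦ max {x ∈ X : x ≤ s}`; hence it
gives mass `b - a` to `[a, b) ∩ X` for `a ≤ b` in `[t₀, ∞) ∩ X`, it is Lebesgue measure on `X`
together with a point mass `μ(t)` at each right-scattered point `t`. Delta integrals
`∫_{t₀}^{t} … Δs` and `∫_{t₀}^{∞} … Δs` are integrals over `[t₀, t)` and `[t₀, ∞)` against it. -/
def deltaMeasure (X : Set ℝ) (t₀ : ℝ) : Measure ℝ :=
  Measure.map (fun s => sSup (X ∩ Iic s)) (volume.restrict (Ici t₀))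

end TimeScale

open TimeScale

/-- `2n × 2n` complex matrices, in `n × n` blocks. -/
abbrev Mat (n : ℕ) : Type := Matrix (Fin n ⊕ Fin n) (Fin n ⊕ Fin n) ℂ

/-- `2n`-vectors `(y₁, y₂)`. -/
abbrev Vec (n : ℕ) : Type := Fin n ⊕ Fin n → ℂ

/-- `Re M = (M + M*) / 2`. -/
def matRe {m : Type*} (M : Matrix m m ℂ) : Matrix m m ℂ := (1 / 2 : ℂ) • (M + Mᴴ)

/-- The data of the Hamiltonian system `J ŷ^Δ = (λ A + B) y` on `[t₀, ∞) ∩ X`, where `X` is a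
Sturmian time scale, `A = diag(A₁, A₂) ≥ 0` and `B = (B₁, B₂; B₃, B₄)` have rd-continuous blocks and
`I + μ B₂`, `I + μ B₃` are invertible. Values of the coefficients off `[t₀, ∞) ∩ X` are
irrelevant. -/
structure HamSystem (n : ℕ) where
  X : Set ℝ
  t₀ : ℝ
  A₁ : ℝ → Matrix (Fin n) (Fin n) ℂ
  A₂ : ℝ → Matrix (Fin n) (Fin n) ℂ
  B₁ : ℝ → Matrix (Fin n) (Fin n) ℂ
  B₂ : ℝ → Matrix (Fin n) (Fin n) ℂ
  B₃ : ℝ → Matrix (Fin n) (Fin n) ℂ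
  B₄ : ℝ → Matrix (Fin n) (Fin n) ℂ
  isClosed_X : IsClosed X
  unbounded_X : ¬ BddAbove X
  t₀_mem : t₀ ∈ X
  sturmian : ∀ t ∈ ray X t₀, sigma X (rho X t) = t ∧ rho X (sigma X t) = t
  rd_A₁ : RdContinuous X t₀ A₁
  rd_A₂ : RdContinuous X t₀ A₂
  rd_B₁ : RdContinuous X t₀ B₁
  rd_B₂ : RdContinuous X t₀ B₂
  rd_B₃ : RdContinuous X t₀ B₃
  rd_B₄ : RdContinuous X t₀ B₄
  posSemidef_A : ∀ t ∈ ray X t₀, (fromBlocks (A₁ t) 0 0 (A₂ t)).PosSemidef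
  isUnit_B₂ : ∀ t ∈ ray X t₀, IsUnit (1 + (mu X t : ℂ) • B₂ t)
  isUnit_B₃ : ∀ t ∈ ray X t₀, IsUnit (1 + (mu X t : ℂ) • B₃ t)

namespace HamSystem

variable {n : ℕ} (S : HamSystem n)

/-- The half-line `[t₀, ∞) ∩ X`. -/
def T : Set ℝ := ray S.X S.t₀

/-- Graininess, as a complex number. -/
def μc (t : ℝ) : ℂ := (mu S.X t : ℂ)

/-- The delta measure on `[t₀, ∞) ∩ X`. -/
def dm : Measure ℝ := deltaMeasure S.X S.t₀

def A (t : ℝ) : Mat n := fromBlocks (S.A₁ t) 0 0 (S.A₂ t)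

def B (t : ℝ) : Mat n := fromBlocks (S.B₁ t) (S.B₂ t) (S.B₃ t) (S.B₄ t)

/-- `E₂ = (I + μ B₂)⁻¹`. -/
def E₂ (t : ℝ) : Matrix (Fin n) (Fin n) ℂ := (1 + S.μc t • S.B₂ t)⁻¹

/-- The matrix `H` with `y = H ŷ` for solutions of `J ŷ^Δ = (λ A + B) y`. -/
def H (lam : ℂ) (t : ℝ) : Mat n :=
  fromBlocks 1 0 (-(S.μc t • (S.E₂ t * (lam • S.A₁ t + S.B₁ t)))) (S.E₂ t)

/-- The matrix `H̃` with `z = H̃ ẑ^σ` for solutions of `J ẑ^Δ = (λ̄ A + B*) z`. -/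
def Htilde (lam : ℂ) (t : ℝ) : Mat n :=
  fromBlocks (S.E₂ t)ᴴ (-(S.μc t • ((S.E₂ t)ᴴ * (star lam • S.A₂ t + (S.B₄ t)ᴴ)))) 0 1

/-- The matrix `N = (0, 0; -μ E₂, 0)`. -/
def N (t : ℝ) : Mat n := fromBlocks 0 0 (-(S.μc t • S.E₂ t)) 0

/-- `Yh = Ŷ(·, λ)` solves `J Ŷ^Δ = (λ A + B) H Ŷ` on `[t₀, ∞) ∩ X` with `Ŷ(t₀) = J`, where
`J = (0, -I; I, 0)`. -/
def IsFundamental (lam : ℂ) (Yh : ℝ → Mat n) : Prop :=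
  Yh S.t₀ = Matrix.J (Fin n) ℂ ∧
  ∀ t ∈ S.T, ∃ D : Mat n, HasMatrixDeltaDeriv S.X S.t₀ Yh D t ∧
    Matrix.J (Fin n) ℂ * D = (lam • S.A t + S.B t) * S.H lam t * Yh t

/-- `Zh = Ẑ(·, λ)` solves `J Ẑ^Δ = (λ̄ A + B*) H̃ Ẑ^σ` on `[t₀, ∞) ∩ X` with `Ẑ(t₀) = J`. -/
def IsAdjointFundamental (lam : ℂ) (Zh : ℝ → Mat n) : Prop :=
  Zh S.t₀ = Matrix.J (Fin n) ℂ ∧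
  ∀ t ∈ S.T, ∃ D : Mat n, HasMatrixDeltaDeriv S.X S.t₀ Zh D t ∧
    Matrix.J (Fin n) ℂ * D =
      (star lam • S.A t + (S.B t)ᴴ) * S.Htilde lam t * Zh (sigma S.X t)

/-- `Y = (θ | φ) = H Ŷ`. -/
def Y (lam : ℂ) (Yh : ℝ → Mat n) (t : ℝ) : Mat n := S.H lam t * Yh t

/-- `Z = (η | χ) = H̃ Ẑ^σ`. -/
def Z (lam : ℂ) (Zh : ℝ → Mat n) (t : ℝ) : Mat n := S.Htilde lam t * Zh (sigma S.X t)

/-- `φ`, the second block column of `Y`. -/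
def phi (lam : ℂ) (Yh : ℝ → Mat n) (t : ℝ) : Matrix (Fin n ⊕ Fin n) (Fin n) ℂ :=
  (S.Y lam Yh t).toCols₂

/-- `χ`, the second block column of `Z`. -/
def chi (lam : ℂ) (Zh : ℝ → Mat n) (t : ℝ) : Matrix (Fin n ⊕ Fin n) (Fin n) ℂ :=
  (S.Z lam Zh t).toCols₂

/-- The Weyl solution `ψ = θ + φ M`. -/
def psi (lam : ℂ) (Yh : ℝ → Mat n) (M : Matrix (Fin n) (Fin n) ℂ) (t : ℝ) :
    Matrix (Fin n ⊕ Fin n) (Fin n) ℂ :=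
  (S.Y lam Yh t).toCols₁ + S.phi lam Yh t * M

/-- The adjoint Weyl solution `ζ = η + χ M*`. -/
def zeta (lam : ℂ) (Zh : ℝ → Mat n) (M : Matrix (Fin n) (Fin n) ℂ) (t : ℝ) :
    Matrix (Fin n ⊕ Fin n) (Fin n) ℂ :=
  (S.Z lam Zh t).toCols₁ + S.chi lam Zh t * Mᴴ

/-- `𝒰₂ₙ = diag(𝒰, -𝒰*)`. -/
def U2 (U : Matrix (Fin n) (Fin n) ℂ) : Mat n := fromBlocks U 0 0 (-Uᴴ)

/-- `W(t, λ) = Re [𝒰₂ₙ (λ A(t) + B(t))]`. -/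
def W (U : Matrix (Fin n) (Fin n) ℂ) (lam : ℂ) (t : ℝ) : Mat n :=
  matRe (U2 U * (lam • S.A t + S.B t))

/-- `Ã = 𝒰₂ₙ A 𝒰₂ₙ*`. -/
def Atilde (U : Matrix (Fin n) (Fin n) ℂ) (t : ℝ) : Mat n := U2 U * S.A t * (U2 U)ᴴ

/-- `(λ₀, 𝒰₂ₙ)` is an admissible pair: `W(t, λ₀) ≥ 0` on `[t₀, ∞) ∩ X`. -/
def Admissible (U : Matrix (Fin n) (Fin n) ℂ) (lam₀ : ℂ) : Prop :=
  ∀ t ∈ S.T, (S.W U lam₀ t).PosSemidef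

/-- `Re [(λ - λ₀) 𝒰₂ₙ A(t)] ≥ δ 𝒰₂ₙ A(t) 𝒰₂ₙ*` for all `t ∈ [t₀, ∞) ∩ X`. -/
def LambdaBound (U : Matrix (Fin n) (Fin n) ℂ) (lam₀ lam : ℂ) (δ : ℝ) : Prop :=
  ∀ t ∈ S.T, (matRe ((lam - lam₀) • (U2 U * S.A t)) - (δ : ℂ) • S.Atilde U t).PosSemidef

/-- The set `Λ(λ₀, 𝒰₂ₙ)`. -/
def Lambda (U : Matrix (Fin n) (Fin n) ℂ) (lam₀ : ℂ) : Set ℂ :=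
  {lam | ∃ δ : ℝ, 0 < δ ∧ S.LambdaBound U lam₀ lam δ}

/-- The set `Λ̃(λ₀, 𝒰₂ₙ⁻¹)`: for some `δ > 0`,
`Re [(λ - λ₀) A(t) 𝒰₂ₙ⁻¹*] ≥ δ 𝒰₂ₙ⁻¹ A(t) 𝒰₂ₙ⁻¹*` for all `t ∈ [t₀, ∞) ∩ X`. -/
def LambdaTilde (U : Matrix (Fin n) (Fin n) ℂ) (lam₀ : ℂ) : Set ℂ :=
  {lam | ∃ δ : ℝ, 0 < δ ∧ ∀ t ∈ S.T,
    (matRe ((lam - lam₀) • (S.A t * ((U2 U)⁻¹)ᴴ))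
      - (δ : ℂ) • ((U2 U)⁻¹ * S.A t * ((U2 U)⁻¹)ᴴ)).PosSemidef}

/-- The Weyl-Sims set `D(t, λ)` of all `l` with `(θ̂ + φ̂ l)* 𝒰₂ₙ J (θ̂ + φ̂ l) ≤ 0` at `t`, in terms
of `Ŷ = (θ̂ | φ̂)`. -/
def weylSet (U : Matrix (Fin n) (Fin n) ℂ) (Yh : ℝ → Mat n) (t : ℝ) :
    Set (Matrix (Fin n) (Fin n) ℂ) :=
  {l | (-(((Yh t).toCols₁ + (Yh t).toCols₂ * l)ᴴ * (U2 U * Matrix.J (Fin n) ℂ) *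
      ((Yh t).toCols₁ + (Yh t).toCols₂ * l))).PosSemidef}

/-- The limiting set `D(∞, λ) = ⋂_{t ≥ t₁} D(t, λ)`. The sets `D(t, λ)` shrink as `t` grows, so it
does not depend on `t₁`, and consists of the `l` that lie in `D(t, λ)` for all large `t`. -/
def weylLimitSet (U : Matrix (Fin n) (Fin n) ℂ) (Yh : ℝ → Mat n) :
    Set (Matrix (Fin n) (Fin n) ℂ) :=
  {l | ∃ t₁ ∈ S.T, ∀ t ∈ S.T, t₁ ≤ t → l ∈ weylSet U Yh t}

/-- `‖y‖²_G = ∫_{t₀}^∞ y*(t) G(t) y(t) Δt ∈ [0, ∞]`, for a weight `G ≥ 0`. -/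
def normSq (G : ℝ → Mat n) (y : ℝ → Vec n) : ℝ≥0∞ :=
  ∫⁻ t, ENNReal.ofReal (star (y t) ⬝ᵥ (G t *ᵥ y t)).re ∂S.dm

/-- `y ∈ L²_G(t₀, ∞)_X`. Two such functions are equal in this space if `‖x - y‖²_G = 0`. -/
def MemL2 (G : ℝ → Mat n) (y : ℝ → Vec n) : Prop :=
  AEStronglyMeasurable y S.dm ∧ S.normSq G y < ∞

/-- The function part of the Green matrix `G(t, s, λ)`, which is `ψ(t) χ*(s)` for `s < t` and
`φ(t) ζ*(s)` for `t ≤ s`; the full Green matrix has in addition the term `N(t) δ_{ts}`. -/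
def green (lam : ℂ) (Yh Zh : ℝ → Mat n) (M : Matrix (Fin n) (Fin n) ℂ) (t s : ℝ) : Mat n :=
  if s < t then S.psi lam Yh M t * (S.chi lam Zh s)ᴴ
  else S.phi lam Yh t * (S.zeta lam Zh M s)ᴴ

/-- `(R_λ f)(t) = ∫_{t₀}^∞ G(t, s, λ) A(s) f(s) Δs`, where the Dirac term `N(t) δ_{ts}` of `G`
contributes `N(t) A(t) f(t)`. -/
def R (lam : ℂ) (Yh Zh : ℝ → Mat n) (M : Matrix (Fin n) (Fin n) ℂ) (f : ℝ → Vec n) (t : ℝ) :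
    Vec n :=
  (∫ s, S.green lam Yh Zh M t s *ᵥ (S.A s *ᵥ f s) ∂S.dm) + S.N t *ᵥ (S.A t *ᵥ f t)

/-- `F ≍ G` on `[t₀, ∞) ∩ X`: `c G(t) ≤ F(t) ≤ C G(t)` with constants `c, C > 0`. -/
def Comparable (F G : ℝ → Mat n) : Prop :=
  ∃ c C : ℝ, 0 < c ∧ 0 < C ∧ ∀ t ∈ S.T,
    (F t - (c : ℂ) • G t).PosSemidef ∧ ((C : ℂ) • G t - F t).PosSemidef

/-- `P` acts as a bounded linear operator on `L²_G(t₀, ∞)_X`: it maps the space into itself,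
respects equality in it, is linear, and `‖P f‖_G ≤ C ‖f‖_G` for some constant `C`. -/
def IsBoundedOperator (G : ℝ → Mat n) (P : (ℝ → Vec n) → ℝ → Vec n) : Prop :=
  (∀ f, S.MemL2 G f → S.MemL2 G (P f)) ∧
  (∀ f g, S.MemL2 G f → S.MemL2 G g → S.normSq G (f - g) = 0 → S.normSq G (P f - P g) = 0) ∧
  (∀ (a b : ℂ) (f g : ℝ → Vec n), S.MemL2 G f → S.MemL2 G g →
    S.normSq G (P (a • f + b • g) - (a • P f + b • P g)) = 0) ∧
  ∃ C : ℝ≥0, ∀ f, S.MemL2 G f → S.normSq G (P f) ≤ (C : ℝ≥0∞) ^ 2 * S.normSq G f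

end HamSystem

end

/-! The proof is an energy argument. The matrix `𝒰₂ₙ J` is Hermitian and off-diagonal, so along `J
ŷ^Δ = w` the form `ŷ* 𝒰₂ₙ J ŷ` has delta derivative `2 Re (y* 𝒰₂ₙ w)`. Here `y` is the half-shift of
`ŷ`: its upper half is taken at `t`, its lower half at `σ(t)`. For solutions this half-shift is
exactly `H ŷ`, or `H ŷ + N q` in the presence of a source `q`. For `w = (λ A + B) y + A f`,
condition (1) bounds `Re (y* 𝒰₂ₙ (λ A + B) y)` below by `y* W(λ₀) y + δ y* Ã y`, and Young's
inequality with weight `ε` absorbs the forcing term (`Matrix.PosSemidef.neg_re_sesq_le`). What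
remains are boundary terms.

On `[t₀, k)` the boundary terms have a favourable sign for the truncated solution `Φ_k`, in which `∫
ζ* A f` runs only up to `k`. Its initial value is isotropic, and its value at `k` lies in the range
of `θ̂ + φ̂ M`, where the form is nonpositive because `M ∈ D(k, λ)`. This is
`lintegral_particular_le`. Since `Φ_k → R_λ f` pointwise, Fatou's lemma gives the estimate on the
half-line (`normSq_R_add_le`), and `ε = δ/2` gives the norm bound.

The limit requires `∫ ζ* A f` to converge, which follows from `ζ ∈ L²_A` (`integrable_sesq_zeta`).
That is the same energy argument for the adjoint system with `𝒰₂ₙ⁻¹`. Its boundary sign at `k` comes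
from duality (`re_sesq_dual_nonpos`): a nonpositive subspace for `𝒰₂ₙ J` has dimension at most `n`,
and the Wronskian identity `Ẑ* J Ŷ = J` carries nonpositivity of `Ŷ (1; M)` over to `Ẑ (1; M*)`.

Calculus on `X` is reduced to the real line by composing with `proj`. The Sturmian condition makes
right-scattered points isolated, so rd-continuous coefficients are continuous on the ray. -/

noncomputable section

open TimeScale

/-! ### Sturmian time scales: jumps, projection onto `X`, continuity -/

namespace TimeScale

/-- The standing assumptions on the time scale: `X` is closed and unbounded above, `t₀ ∈ X`, and
the Sturmian condition holds on `[t₀, ∞) ∩ X`. -/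
structure IsSturmian (X : Set ℝ) (t₀ : ℝ) : Prop where
  isClosed : IsClosed X
  unbounded : ¬ BddAbove X
  mem : t₀ ∈ X
  jump : ∀ t ∈ ray X t₀, sigma X (rho X t) = t ∧ rho X (sigma X t) = t

/-- The largest point of `X` below `max s t₀`. -/
def proj (X : Set ℝ) (t₀ s : ℝ) : ℝ := sSup (X ∩ Iic (max s t₀))

namespace IsSturmian

variable {X : Set ℝ} {t₀ : ℝ} (h : IsSturmian X t₀)
include h

theorem isClosed_ray : IsClosed (ray X t₀) := h.isClosed.inter isClosed_Ici

theorem left_mem_ray : t₀ ∈ ray X t₀ := ⟨h.mem, mem_Ici.2 le_rfl⟩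

theorem exists_gt (t : ℝ) : ∃ s ∈ X, t < s := by
  have := h.unbounded
  rw [not_bddAbove_iff] at this
  exact this t

theorem isGLB_sigma (t : ℝ) : IsGLB {s | s ∈ X ∧ t < s} (sigma X t) := by
  obtain ⟨s, hs, hts⟩ := h.exists_gt t
  exact isGLB_csInf ⟨s, hs, hts⟩ ⟨t, fun r hr => hr.2.le⟩

theorem le_sigma (t : ℝ) : t ≤ sigma X t := (h.isGLB_sigma t).2 fun _ hr => hr.2.le

theorem sigma_le {t s : ℝ} (hs : s ∈ X) (hts : t < s) : sigma X t ≤ s :=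
  (h.isGLB_sigma t).1 ⟨hs, hts⟩

theorem sigma_mem (t : ℝ) : sigma X t ∈ X := by
  obtain ⟨s, hs, hts⟩ := h.exists_gt t
  have := (h.isGLB_sigma t).mem_closure ⟨s, hs, hts⟩
  exact closure_minimal (fun r hr => hr.1) h.isClosed this

theorem sigma_mem_ray {t : ℝ} (ht : t ∈ ray X t₀) : sigma X t ∈ ray X t₀ :=
  ⟨h.sigma_mem t, le_trans (mem_Ici.1 ht.2) (h.le_sigma t)⟩

theorem isGreatest_proj (s : ℝ) : IsGreatest (X ∩ Iic (max s t₀)) (proj X t₀ s) :=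
  (h.isClosed.inter isClosed_Iic).isGreatest_csSup ⟨t₀, h.mem, mem_Iic.2 (le_max_right _ _)⟩
    ⟨max s t₀, fun _ hr => hr.2⟩

theorem proj_mem_ray (s : ℝ) : proj X t₀ s ∈ ray X t₀ :=
  ⟨(h.isGreatest_proj s).1.1, (h.isGreatest_proj s).2 ⟨h.mem, mem_Iic.2 (le_max_right _ _)⟩⟩

theorem proj_le {s : ℝ} (hs : t₀ ≤ s) : proj X t₀ s ≤ s := by
  simpa [hs] using (h.isGreatest_proj s).1.2

theorem le_proj {s x : ℝ} (hx : x ∈ X) (hxs : x ≤ s) : x ≤ proj X t₀ s :=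
  (h.isGreatest_proj s).2 ⟨hx, hxs.trans (le_max_left _ _)⟩

theorem proj_of_mem {t : ℝ} (ht : t ∈ ray X t₀) : proj X t₀ t = t :=
  le_antisymm (h.proj_le ht.2) (h.le_proj ht.1 le_rfl)

theorem proj_of_le {s : ℝ} (hs : s ≤ t₀) : proj X t₀ s = t₀ := by
  have : proj X t₀ s = proj X t₀ t₀ := by simp [proj, hs]
  rw [this, h.proj_of_mem h.left_mem_ray]

theorem monotone_proj : Monotone (proj X t₀) := fun _ _ hab =>
  (h.isGreatest_proj _).2 ⟨(h.isGreatest_proj _).1.1,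
    (h.isGreatest_proj _).1.2.trans (max_le_max_right _ hab)⟩

theorem measurable_proj : Measurable (proj X t₀) := h.monotone_proj.measurable

theorem proj_lt_iff {s t : ℝ} (hs : t₀ ≤ s) (ht : t ∈ X) : proj X t₀ s < t ↔ s < t :=
  ⟨fun hlt => lt_of_not_ge fun hts => absurd (h.le_proj ht hts) hlt.not_ge,
    fun hlt => (h.proj_le hs).trans_lt hlt⟩

theorem proj_eq_of_mem_Ico {t s : ℝ} (ht : t ∈ ray X t₀) (hs : s ∈ Ico t (sigma X t)) :
    proj X t₀ s = t := by
  have h0 : t₀ ≤ s := le_trans ht.2 hs.1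
  refine le_antisymm (le_of_not_gt fun hlt => ?_) (h.le_proj ht.1 hs.1)
  exact absurd (h.sigma_le (h.proj_mem_ray s).1 hlt) (not_le.2 ((h.proj_le h0).trans_lt hs.2))

/-- If `σ(p) ≤ s` for `p = proj s < s`, maximality of `p` forces `σ(p) = p`; then `X` has points in
`(p, s)`, again contradicting maximality. So a real number outside `X` lies strictly inside a gap.
-/
theorem proj_eq_self_or {s : ℝ} (hs : t₀ ≤ s) :
    s ∈ ray X t₀ ∨ (proj X t₀ s < s ∧ s < sigma X (proj X t₀ s)) := by
  rcases (h.proj_le hs).eq_or_lt with he | hlt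
  · left; rw [← he]; exact h.proj_mem_ray s
  · right
    refine ⟨hlt, lt_of_not_ge fun hle => ?_⟩
    have h1 := h.le_proj (h.sigma_mem (proj X t₀ s)) hle
    have h2 := le_antisymm h1 (h.le_sigma _)
    have h3 := (h.isGLB_sigma (proj X t₀ s))
    rw [h2] at h3
    obtain ⟨r, hr, -, hr2⟩ := h3.exists_between hlt
    exact absurd (h.le_proj hr.1 hr2.le) (not_le.2 hr.2)

/-- A right-scattered point is also left-scattered. At the least element of `X` the convention `ρ(t)
= t` turns the Sturmian condition into `σ(t) = t`, so that case cannot occur. The point `r` may lie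
to the left of `t₀`. -/
theorem rho_lt_of_scattered {t : ℝ} (ht : t ∈ ray X t₀) (hs : sigma X t ≠ t) :
    ∃ r ∈ X, r < t ∧ sigma X r = t := by
  have h1 := (h.jump t ht).1
  by_cases hex : ∃ s ∈ X, s < t
  · obtain ⟨s, hs1, hs2⟩ := hex
    have hl : IsLUB {s | s ∈ X ∧ s < t} (rho X t) := by
      rw [rho, if_pos ⟨s, hs1, hs2⟩]
      exact isLUB_csSup ⟨s, hs1, hs2⟩ ⟨t, fun r hr => hr.2.le⟩
    have hm : rho X t ∈ X :=
      closure_minimal (fun r hr => hr.1) h.isClosed (hl.mem_closure ⟨s, hs1, hs2⟩)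
    have hle : rho X t ≤ t := hl.2 fun r hr => hr.2.le
    refine ⟨rho X t, hm, hle.lt_of_ne fun he => hs ?_, h1⟩
    rw [he] at h1; exact h1
  · rw [rho, if_neg hex] at h1
    exact absurd h1 hs

/-- There is a gap on both sides of a right-scattered point, so it is isolated. Limits therefore
matter only at right-dense points. -/
theorem nhdsWithin_eq_pure {t : ℝ} (ht : t ∈ ray X t₀) (hs : sigma X t ≠ t) :
    𝓝[ray X t₀] t = pure t := by
  obtain ⟨r, hr, hrt, hrs⟩ := h.rho_lt_of_scattered ht hs
  have hlt : t < sigma X t := (h.le_sigma t).lt_of_ne' hs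
  refine le_antisymm ?_ (pure_le_nhdsWithin ht)
  rw [le_pure_iff]
  refine mem_nhdsWithin.2 ⟨Ioo r (sigma X t), isOpen_Ioo, ⟨hrt, hlt⟩, fun x hx => ?_⟩
  rcases lt_trichotomy x t with hx1 | hx1 | hx1
  · have := h.sigma_le hx.2.1 hx.1.1
    rw [hrs] at this; exact absurd this (not_le.2 hx1)
  · exact hx1
  · exact absurd (h.sigma_le hx.2.1 hx1) (not_le.2 hx.1.2)

theorem continuousOn_of_dense {E : Type*} [TopologicalSpace E] {g : ℝ → E}
    (hg : ∀ t ∈ ray X t₀, sigma X t = t → ContinuousWithinAt g (ray X t₀) t) :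
    ContinuousOn g (ray X t₀) := by
  intro t ht
  by_cases hs : sigma X t = t
  · exact hg t ht hs
  · rw [ContinuousWithinAt, h.nhdsWithin_eq_pure ht hs]
    exact tendsto_pure_nhds _ _

theorem continuousOn_of_rdContinuous {E : Type*} [TopologicalSpace E] {g : ℝ → E}
    (hg : RdContinuous X t₀ g) : ContinuousOn g (ray X t₀) :=
  h.continuousOn_of_dense fun t ht => (hg t ht).1

theorem exists_between_of_dense {t : ℝ} (hs : sigma X t = t) {b : ℝ} (hb : t < b) :
    ∃ c ∈ X, t < c ∧ c < b := by
  have h3 := h.isGLB_sigma t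
  rw [hs] at h3
  obtain ⟨r, hr, -, hr2⟩ := h3.exists_between hb
  exact ⟨r, hr.1, hr.2, hr2⟩

theorem continuousOn_sigma : ContinuousOn (sigma X) (ray X t₀) := by
  refine h.continuousOn_of_dense fun t ht hs => ?_
  rw [ContinuousWithinAt, hs, tendsto_order]
  constructor
  · intro a ha
    filter_upwards [mem_nhdsWithin_of_mem_nhds (lt_mem_nhds ha)] with x hx
    exact lt_of_lt_of_le hx (h.le_sigma x)
  · intro b hb
    obtain ⟨c, hc, htc, hcb⟩ := h.exists_between_of_dense hs hb
    filter_upwards [mem_nhdsWithin_of_mem_nhds (gt_mem_nhds htc)] with x hx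
    exact (h.sigma_le hc hx).trans_lt hcb

theorem continuousOn_mu : ContinuousOn (mu X) (ray X t₀) := h.continuousOn_sigma.sub continuousOn_id

theorem rho_eq_of_dense {t : ℝ} (ht : t ∈ ray X t₀) (hs : sigma X t = t) : rho X t = t := by
  have := (h.jump t ht).2
  rwa [hs] at this

theorem exists_between_of_dense_left {t : ℝ} (ht : t ∈ ray X t₀) (hs : sigma X t = t)
    (ht0 : t₀ < t) {a : ℝ} (ha : a < t) : ∃ c ∈ X, a < c ∧ c < t := by
  have hr := h.rho_eq_of_dense ht hs
  rw [rho, if_pos ⟨t₀, h.mem, ht0⟩] at hr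
  have hl : IsLUB {s | s ∈ X ∧ s < t} t := by
    conv => rhs; rw [← hr]
    exact isLUB_csSup ⟨t₀, h.mem, ht0⟩ ⟨t, fun r hr => hr.2.le⟩
  obtain ⟨r, hr, hr1, -⟩ := hl.exists_between ha
  exact ⟨r, hr.1, hr1, hr.2⟩

/-- A right-dense point beyond `t₀` is left-dense as well, so points of `X` squeeze `proj` from the
left. At `t₀` itself `proj ≥ t₀` suffices. -/
theorem continuousAt_proj {t : ℝ} (ht : t ∈ ray X t₀) (hs : sigma X t = t) :
    ContinuousAt (proj X t₀) t := by
  rw [ContinuousAt, h.proj_of_mem ht, tendsto_order]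
  have ht0 : t₀ ≤ t := ht.2
  constructor
  · intro a ha
    rcases ht0.eq_or_lt with he | hlt
    · exact Eventually.of_forall fun x => (ha.trans_le he.ge).trans_le (h.proj_mem_ray x).2
    · obtain ⟨c, hc, hac, hct⟩ := h.exists_between_of_dense_left ht hs hlt ha
      filter_upwards [lt_mem_nhds hct] with x hx
      exact hac.trans_le (h.le_proj hc hx.le)
  · intro b hb
    filter_upwards [gt_mem_nhds hb] with x hx
    rcases le_total t₀ x with h1 | h1
    · exact (h.proj_le h1).trans_lt hx
    · rw [h.proj_of_le h1]; exact ht0.trans_lt hb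

theorem tendsto_proj {t : ℝ} (ht : t ∈ ray X t₀) (hs : sigma X t = t) :
    Tendsto (proj X t₀) (𝓝 t) (𝓝[ray X t₀] t) := by
  refine tendsto_nhdsWithin_iff.2 ⟨?_, Eventually.of_forall h.proj_mem_ray⟩
  have := h.continuousAt_proj ht hs
  rwa [ContinuousAt, h.proj_of_mem ht] at this

omit h in
theorem hasDerivWithinAt_of_hasDeltaDeriv {g : ℝ → ℂ} {d : ℂ} {t : ℝ} (hs : sigma X t = t)
    (hg : HasDeltaDeriv X t₀ g d t) : HasDerivWithinAt g d (ray X t₀) t := by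
  rw [hasDerivWithinAt_iff_isLittleO, Asymptotics.isLittleO_iff]
  intro ε hε
  filter_upwards [hg ε hε] with s hs'
  rw [hs] at hs'
  rw [abs_sub_comm, norm_sub_rev] at hs'
  have he : g s - g t - (s - t) • d = ((t - s : ℝ) : ℂ) * d - (g t - g s) := by
    rw [Complex.real_smul]
    push_cast
    ring
  rw [he]
  exact hs'

omit h in
-- The defining estimate may be tested at `s = t`, where its left-hand side does not depend on `ε`.
theorem map_sigma_of_hasDeltaDeriv {g : ℝ → ℂ} {d : ℂ} {t : ℝ} (ht : t ∈ ray X t₀)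
    (hg : HasDeltaDeriv X t₀ g d t) : g (sigma X t) = g t + (mu X t : ℂ) * d := by
  have key : ∀ ε : ℝ, 0 < ε → ‖g (sigma X t) - g t - ((mu X t : ℝ) : ℂ) * d‖ ≤ ε * |mu X t| :=
    fun ε hε => (hg ε hε).self_of_nhdsWithin ht
  have : ‖g (sigma X t) - g t - ((mu X t : ℝ) : ℂ) * d‖ ≤ 0 := by
    refine le_of_forall_pos_le_add fun ε hε => ?_
    refine (key (ε / (|mu X t| + 1)) (by positivity)).trans ?_
    rw [zero_add, div_mul_eq_mul_div, div_le_iff₀ (by positivity)]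
    nlinarith [abs_nonneg (mu X t)]
  have h2 := norm_le_zero_iff.1 this
  linear_combination h2

theorem continuousOn_of_hasDeltaDeriv {g d : ℝ → ℂ}
    (hg : ∀ t ∈ ray X t₀, HasDeltaDeriv X t₀ g (d t) t) : ContinuousOn g (ray X t₀) :=
  h.continuousOn_of_dense fun t ht hs =>
    (hasDerivWithinAt_of_hasDeltaDeriv hs (hg t ht)).continuousWithinAt

/-- A function on `X` which is constant across gaps and has derivative zero at dense points is
constant. -/
theorem eq_of_deriv_zero {g : ℝ → ℂ} (hgap : ∀ t ∈ ray X t₀, g (sigma X t) = g t)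
    (hden : ∀ t ∈ ray X t₀, sigma X t = t → HasDerivWithinAt g 0 (ray X t₀) t) :
    ∀ t ∈ ray X t₀, g t = g t₀ := by
  -- Consider `g ∘ proj` on the real line. It is locally constant inside gaps and also at isolated
  -- points, where `hgap` glues the two sides. Only dense points of `X` remain.
  have key : ∀ x, t₀ ≤ x → (∀ᶠ y in 𝓝 x, g (proj X t₀ y) = g (proj X t₀ x)) ∨
      (x ∈ ray X t₀ ∧ sigma X x = x) := by
    intro x hx
    rcases h.proj_eq_self_or hx with hmem | ⟨h1, h2⟩
    · by_cases hs : sigma X x = x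
      · exact Or.inr ⟨hmem, hs⟩
      left
      obtain ⟨r, hr, hrx, hrs⟩ := h.rho_lt_of_scattered hmem hs
      filter_upwards [Ioo_mem_nhds hrx ((h.le_sigma x).lt_of_ne' hs)] with y hy
      rw [h.proj_of_mem hmem]
      rcases le_or_gt x y with hxy | hxy
      · rw [h.proj_eq_of_mem_Ico hmem ⟨hxy, hy.2⟩]
      rcases le_or_gt t₀ r with h0 | h0
      · rw [h.proj_eq_of_mem_Ico ⟨hr, h0⟩ ⟨hy.1.le, hrs ▸ hxy⟩, ← hgap r ⟨hr, h0⟩, hrs]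
      -- The left neighbour lies below `t₀`, which forces `x = t₀`; to the left of `t₀` the
      -- projection is constant.
      · have hx0 : x ≤ t₀ := hrs ▸ h.sigma_le h.mem h0
        rw [h.proj_of_le (hxy.le.trans hx0), le_antisymm hx0 hx]
    · left
      filter_upwards [Ioo_mem_nhds h1 h2] with y hy
      rw [h.proj_eq_of_mem_Ico (h.proj_mem_ray x) ⟨hy.1.le, hy.2⟩]
  intro t ht
  have := constant_of_has_deriv_right_zero (f := fun s => g (proj X t₀ s)) (a := t₀) (b := t)
    ?_ ?_ t ⟨ht.2, le_rfl⟩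
  · simpa [h.proj_of_mem ht, h.proj_of_mem h.left_mem_ray] using this
  · intro x hx
    refine ContinuousAt.continuousWithinAt ?_
    rcases key x hx.1 with he | ⟨hm, hs⟩
    · exact continuousAt_const.congr (he.mono fun y hy => hy.symm)
    · have h1 := (hden x hm hs).continuousWithinAt.tendsto.comp (h.tendsto_proj hm hs)
      rwa [ContinuousAt, h.proj_of_mem hm]
  · intro x hx
    rcases key x hx.1 with he | ⟨hm, hs⟩
    · exact ((hasDerivAt_const x (g (proj X t₀ x))).congr_of_eventuallyEq he).hasDerivWithinAt
    · have h1 := hden x hm hs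
      rw [hasDerivWithinAt_iff_isLittleO, Asymptotics.isLittleO_iff] at h1 ⊢
      intro ε hε
      have h2 := (h.tendsto_proj hm hs).eventually (h1 hε)
      filter_upwards [mem_nhdsWithin_of_mem_nhds h2, self_mem_nhdsWithin] with y hy hxy
      rw [h.proj_of_mem hm]
      simp only [smul_zero, sub_zero] at hy ⊢
      -- For `y` to the right of `x`, `x ≤ proj y ≤ y`, so projecting does not increase the distance
      -- to `x` and the little-o bound survives.
      refine hy.trans (mul_le_mul_of_nonneg_left ?_ hε.le)
      have hxy' : x ≤ y := hxy
      have h3 := h.le_proj hm.1 hxy'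
      rw [Real.norm_of_nonneg (by linarith), Real.norm_of_nonneg (by linarith)]
      linarith [h.proj_le (hx.1.trans hxy')]

end IsSturmian
end TimeScale

/-! ### The delta measure and the fundamental theorem of calculus -/

namespace TimeScale
namespace IsSturmian

variable {X : Set ℝ} {t₀ : ℝ} (h : IsSturmian X t₀)

instance : SFinite (deltaMeasure X t₀) := by
  unfold deltaMeasure; infer_instance

include h

omit h in
theorem deltaMeasure_eq :
    deltaMeasure X t₀ = Measure.map (proj X t₀) (volume.restrict (Ici t₀)) := by
  refine Measure.map_congr ?_
  filter_upwards [ae_restrict_mem measurableSet_Ici] with s hs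
  have : t₀ ≤ s := hs
  simp [proj, this]

theorem measurableSet_ray : MeasurableSet (ray X t₀) := h.isClosed_ray.measurableSet

theorem ae_mem_ray : ∀ᵐ t ∂deltaMeasure X t₀, t ∈ ray X t₀ := by
  rw [deltaMeasure_eq, ae_map_iff h.measurable_proj.aemeasurable (p := fun t => t ∈ ray X t₀)
    h.measurableSet_ray]
  exact Eventually.of_forall h.proj_mem_ray

theorem restrict_ray : (deltaMeasure X t₀).restrict (ray X t₀) = deltaMeasure X t₀ :=
  Measure.restrict_eq_self_of_ae_mem h.ae_mem_ray

/-- For an endpoint `t ∈ X` and `s ≥ t₀`, `proj s < t` is equivalent to `s < t`, so the interval is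
its own preimage. -/
theorem restrict_Ico {t : ℝ} (ht : t ∈ ray X t₀) : (deltaMeasure X t₀).restrict (Ico t₀ t) =
    Measure.map (proj X t₀) (volume.restrict (Ico t₀ t)) := by
  rw [deltaMeasure_eq, Measure.restrict_map h.measurable_proj measurableSet_Ico,
    Measure.restrict_restrict (h.measurable_proj measurableSet_Ico)]
  congr 2
  ext s
  simp only [mem_inter_iff, mem_preimage, mem_Ico, mem_Ici]
  constructor
  · rintro ⟨⟨-, h2⟩, h3⟩
    exact ⟨h3, (h.proj_lt_iff h3 ht.1).1 h2⟩
  · rintro ⟨h1, h2⟩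
    exact ⟨⟨(h.proj_mem_ray s).2, (h.proj_lt_iff h1 ht.1).2 h2⟩, h1⟩

theorem deltaMeasure_Ico {t : ℝ} (ht : t ∈ ray X t₀) :
    deltaMeasure X t₀ (Ico t₀ t) = ENNReal.ofReal (t - t₀) := by
  rw [← Measure.restrict_apply_univ, h.restrict_Ico ht,
    Measure.map_apply h.measurable_proj MeasurableSet.univ]
  simp

theorem aestronglyMeasurable {E : Type*} [TopologicalSpace E]
    [TopologicalSpace.PseudoMetrizableSpace E] [SecondCountableTopology E] {g : ℝ → E}
    (hg : ContinuousOn g (ray X t₀)) : AEStronglyMeasurable g (deltaMeasure X t₀) := by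
  borelize E
  rw [← h.restrict_ray]
  exact hg.aestronglyMeasurable h.measurableSet_ray

theorem exists_bound {g : ℝ → ℂ} (hg : ContinuousOn g (ray X t₀)) (t : ℝ) :
    ∃ C, ∀ s ∈ ray X t₀, s ≤ t → ‖g s‖ ≤ C := by
  have hc : IsCompact (ray X t₀ ∩ Icc t₀ t) := isCompact_Icc.inter_left h.isClosed_ray
  obtain ⟨C, hC⟩ := hc.exists_bound_of_continuousOn (hg.mono inter_subset_left)
  exact ⟨C, fun s hs hst => hC s ⟨hs, hs.2, hst⟩⟩

theorem integrableOn_Ico {g : ℝ → ℂ} (hg : ContinuousOn g (ray X t₀)) {t : ℝ}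
    (ht : t ∈ ray X t₀) : IntegrableOn g (Ico t₀ t) (deltaMeasure X t₀) := by
  obtain ⟨C, hC⟩ := h.exists_bound hg t
  refine Measure.integrableOn_of_bounded (M := C) ?_ (h.aestronglyMeasurable hg) ?_
  · rw [h.deltaMeasure_Ico ht]; exact ENNReal.ofReal_ne_top
  · filter_upwards [ae_restrict_mem measurableSet_Ico, ae_restrict_of_ae h.ae_mem_ray] with s h1 h2
    exact hC s h2 h1.2.le

theorem intervalIntegrable_proj {D : ℝ → ℂ} (hD : ContinuousOn D (ray X t₀)) {t : ℝ}
    (ht : t ∈ ray X t₀) : IntervalIntegrable (fun s => D (proj X t₀ s)) volume t₀ t := by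
  rw [intervalIntegrable_iff_integrableOn_Ico_of_le ht.2]
  have h1 := h.integrableOn_Ico hD ht
  rw [IntegrableOn, h.restrict_Ico ht] at h1
  exact h1.comp_measurable h.measurable_proj

theorem integral_Ico {D : ℝ → ℂ} (hD : ContinuousOn D (ray X t₀)) {t : ℝ}
    (ht : t ∈ ray X t₀) :
    ∫ s in Ico t₀ t, D s ∂deltaMeasure X t₀ = ∫ s in t₀..t, D (proj X t₀ s) := by
  have h1 := h.integrableOn_Ico hD ht
  rw [IntegrableOn, h.restrict_Ico ht] at h1
  rw [h.restrict_Ico ht, integral_map h.measurable_proj.aemeasurable h1.1,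
    intervalIntegral.integral_of_le ht.2, integral_Ico_eq_integral_Ioo,
    integral_Ioc_eq_integral_Ioo]

theorem integral_gap (D : ℝ → ℂ) {t : ℝ} (ht : t ∈ ray X t₀) :
    ∫ s in t..sigma X t, D (proj X t₀ s) = (mu X t : ℂ) * D t := by
  have : ∫ s in t..sigma X t, D (proj X t₀ s) = ∫ s in t..sigma X t, D t := by
    rw [intervalIntegral.integral_of_le (h.le_sigma t),
      intervalIntegral.integral_of_le (h.le_sigma t), ← integral_Ico_eq_integral_Ioc,
      ← integral_Ico_eq_integral_Ioc]
    exact setIntegral_congr_fun measurableSet_Ico fun s hs => by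
      simp only [h.proj_eq_of_mem_Ico ht hs]
  rw [this, intervalIntegral.integral_const, mu, Complex.real_smul]

/-- The difference `F - ∫ D ∘ proj` does not change across gaps and has derivative zero at dense
points, hence is constant by `eq_of_deriv_zero`. -/
theorem integral_deriv_eq_sub {F D : ℝ → ℂ} (hD : ContinuousOn D (ray X t₀))
    (hF : ∀ t ∈ ray X t₀, HasDeltaDeriv X t₀ F (D t) t) {t : ℝ} (ht : t ∈ ray X t₀) :
    F t = F t₀ + ∫ s in Ico t₀ t, D s ∂deltaMeasure X t₀ := by
  have key := h.eq_of_deriv_zero (g := fun t => F t - ∫ s in t₀..t, D (proj X t₀ s)) ?_ ?_ t ht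
  · rw [h.integral_Ico hD ht]
    simp only [intervalIntegral.integral_same, sub_zero] at key
    rw [← key]; ring
  · intro s hs
    have h1 := intervalIntegral.integral_add_adjacent_intervals
      (h.intervalIntegrable_proj hD hs)
      ((h.intervalIntegrable_proj hD hs).symm.trans
        (h.intervalIntegrable_proj hD (h.sigma_mem_ray hs)))
    rw [← h1, h.integral_gap D hs, map_sigma_of_hasDeltaDeriv hs (hF s hs)]
    ring
  · intro s hs hsig
    have h1 := hasDerivWithinAt_of_hasDeltaDeriv hsig (hF s hs)
    have hc : ContinuousAt (fun s => D (proj X t₀ s)) s := by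
      have := (hD s hs).tendsto.comp (h.tendsto_proj hs hsig)
      rwa [ContinuousAt, h.proj_of_mem hs]
    -- When `s = t₀` a neighbourhood reaches to the left of the half-line; there `proj` is constant,
    -- so measurability is not lost.
    have hm : StronglyMeasurableAtFilter (fun s => D (proj X t₀ s)) (𝓝 s) volume := by
      obtain ⟨b, hb, hsb⟩ := h.exists_gt s
      have hb0 : b ∈ ray X t₀ := ⟨hb, hs.2.trans hsb.le⟩
      refine ⟨Ioo (t₀ - 1) b, Ioo_mem_nhds (by linarith [mem_Ici.1 hs.2]) hsb, ?_⟩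
      have hm1 : AEStronglyMeasurable (fun s => D (proj X t₀ s)) (volume.restrict (Ico t₀ b)) := by
        have := h.integrableOn_Ico hD hb0
        rw [IntegrableOn, h.restrict_Ico hb0] at this
        exact (this.comp_measurable h.measurable_proj).1
      have hm2 : AEStronglyMeasurable (fun s => D (proj X t₀ s)) (volume.restrict (Iio t₀)) := by
        refine (aestronglyMeasurable_const (b := D t₀)).congr ?_
        filter_upwards [ae_restrict_mem measurableSet_Iio] with r hr
        rw [h.proj_of_le (le_of_lt hr)]
      refine ((aestronglyMeasurable_union_iff).2 ⟨hm2, hm1⟩).mono_measure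
        (Measure.restrict_mono (fun r hr => ?_) le_rfl)
      rcases lt_or_ge r t₀ with h2 | h2
      · exact Or.inl h2
      · exact Or.inr ⟨h2, hr.2⟩
    have h2 := intervalIntegral.integral_hasDerivAt_right (h.intervalIntegrable_proj hD hs) hm hc
    rw [h.proj_of_mem hs] at h2
    have h3 := h1.sub h2.hasDerivWithinAt
    rw [sub_self] at h3
    exact h3

theorem deltaMeasure_singleton {t : ℝ} (ht : t ∈ ray X t₀) :
    deltaMeasure X t₀ {t} = ENNReal.ofReal (mu X t) := by
  rw [deltaMeasure_eq, Measure.map_apply h.measurable_proj (measurableSet_singleton t),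
    Measure.restrict_apply (h.measurable_proj (measurableSet_singleton t))]
  refine le_antisymm ?_ ?_
  · rw [mu, ← Real.volume_Icc]
    refine measure_mono fun s hs => ?_
    obtain ⟨h1, h2⟩ := hs
    have h1 : proj X t₀ s = t := h1
    refine ⟨h1 ▸ h.proj_le h2, le_of_not_gt fun hlt => ?_⟩
    have h3 := h.le_proj (h.sigma_mem t) hlt.le
    rw [h1] at h3
    have h4 := le_antisymm h3 (h.le_sigma t)
    obtain ⟨c, hc, htc, hcs⟩ := h.exists_between_of_dense h4 (h4 ▸ hlt)
    exact absurd (h.le_proj hc hcs.le) (by rw [h1]; exact not_le.2 htc)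
  · rw [mu, ← Real.volume_Ico]
    exact measure_mono fun s hs => ⟨h.proj_eq_of_mem_Ico ht hs, le_trans (mem_Ici.1 ht.2) hs.1⟩

/-- At a dense point `{t}` is null, and at a scattered point `X` has nothing in `(t, σ(t))`. This
expresses values at `σ(t)` through integrals that include the atom at `t`, which is how the shift
enters the product rule. -/
theorem Ico_sigma_ae_eq {t : ℝ} (ht : t ∈ ray X t₀) :
    Ico t₀ (sigma X t) =ᵐ[deltaMeasure X t₀] Icc t₀ t := by
  by_cases hs : sigma X t = t
  · rw [hs, ae_eq_set]
    refine ⟨?_, ?_⟩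
    · rw [sdiff_eq_empty.2 Ico_subset_Icc_self, measure_empty]
    · refine measure_mono_null (t := {t}) ?_ ?_
      · rintro s ⟨h1, h2⟩
        exact le_antisymm h1.2 (le_of_not_gt fun hlt => h2 ⟨h1.1, hlt⟩)
      · rw [h.deltaMeasure_singleton ht, mu, hs]; simp
  · filter_upwards [h.ae_mem_ray] with s hs'
    refine propext ⟨fun h1 => ⟨h1.1, le_of_not_gt fun hlt => ?_⟩,
      fun h1 => ⟨h1.1, h1.2.trans_lt ((h.le_sigma t).lt_of_ne' hs)⟩⟩
    exact absurd (h.sigma_le hs'.1 hlt) (not_le.2 h1.2)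

end IsSturmian

/-! ### Absolutely continuous functions and the product rule -/

/-- Integration by parts over the square: the two triangles. -/
theorem integral_mul_integral {ν : Measure ℝ} [SFinite ν] {D E : ℝ → ℂ}
    (hD : Integrable D ν) (hE : Integrable E ν) :
    Integrable (fun s => D s * ∫ r in Iic s, E r ∂ν) ν ∧
    Integrable (fun r => (∫ s in Iio r, D s ∂ν) * E r) ν ∧
    (∫ s, D s ∂ν) * ∫ r, E r ∂ν =
      (∫ s, D s * ∫ r in Iic s, E r ∂ν ∂ν) + ∫ r, (∫ s in Iio r, D s ∂ν) * E r ∂ν := by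
  have hp : Integrable (fun z : ℝ × ℝ => D z.1 * E z.2) (ν.prod ν) := hD.mul_prod hE
  -- The diagonal carries mass wherever `ν` has atoms. It is assigned to the triangle `r ≤ s`, hence
  -- `Iic` in one inner integral and `Iio` in the other.
  have hA : MeasurableSet {z : ℝ × ℝ | z.2 ≤ z.1} := measurableSet_le measurable_snd measurable_fst
  have h1 := hp.indicator hA
  have h2 := hp.indicator hA.compl
  have e1 : ∀ s, ∫ r, ({z : ℝ × ℝ | z.2 ≤ z.1}.indicator (fun z => D z.1 * E z.2) (s, r)) ∂ν =
      D s * ∫ r in Iic s, E r ∂ν := by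
    intro s
    rw [← integral_const_mul, ← integral_indicator measurableSet_Iic]
    refine integral_congr_ae (Eventually.of_forall fun r => ?_)
    by_cases hrs : r ≤ s <;> simp [hrs]
  have e2 : ∀ r, ∫ s, ({z : ℝ × ℝ | z.2 ≤ z.1}ᶜ.indicator (fun z => D z.1 * E z.2) (s, r)) ∂ν =
      (∫ s in Iio r, D s ∂ν) * E r := by
    intro r
    rw [← integral_mul_const, ← integral_indicator measurableSet_Iio]
    refine integral_congr_ae (Eventually.of_forall fun s => ?_)
    by_cases hrs : r ≤ s
    · simp [hrs, hrs.not_gt]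
    · simp [hrs, lt_of_not_ge hrs]
  refine ⟨?_, ?_, ?_⟩
  · simpa only [e1] using h1.integral_prod_left
  · simpa only [e2] using h2.integral_prod_right
  · rw [← integral_prod_mul, ← integral_add_compl hA hp, ← integral_indicator hA,
      ← integral_indicator hA.compl, integral_prod _ h1, integral_prod_symm _ h2]
    simp only [e1, e2]

/-- `F` is absolutely continuous on `[t₀, ∞) ∩ X` with almost everywhere delta derivative `D`. -/
structure DeltaAC (X : Set ℝ) (t₀ : ℝ) (F D : ℝ → ℂ) : Prop where
  integrable : ∀ t ∈ ray X t₀, IntegrableOn D (Ico t₀ t) (deltaMeasure X t₀)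
  eq : ∀ t ∈ ray X t₀, F t = F t₀ + ∫ s in Ico t₀ t, D s ∂deltaMeasure X t₀

namespace DeltaAC

variable {X : Set ℝ} {t₀ : ℝ} {F G D E : ℝ → ℂ}

theorem add (hF : DeltaAC X t₀ F D) (hG : DeltaAC X t₀ G E) :
    DeltaAC X t₀ (fun t => F t + G t) (fun t => D t + E t) where
  integrable t ht := (hF.integrable t ht).add (hG.integrable t ht)
  eq t ht := by
    rw [integral_add (hF.integrable t ht) (hG.integrable t ht), hF.eq t ht, hG.eq t ht]
    ring

theorem const (c : ℂ) : DeltaAC X t₀ (fun _ => c) (fun _ => 0) where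
  integrable t ht := integrableOn_zero
  eq t ht := by simp

theorem sum {ι : Type*} (s : Finset ι) {F D : ι → ℝ → ℂ}
    (hF : ∀ i ∈ s, DeltaAC X t₀ (F i) (D i)) :
    DeltaAC X t₀ (fun t => ∑ i ∈ s, F i t) (fun t => ∑ i ∈ s, D i t) where
  integrable t ht := integrable_finsetSum _ fun i hi => (hF i hi).integrable t ht
  eq t ht := by
    rw [integral_finsetSum _ fun i hi => (hF i hi).integrable t ht, ← Finset.sum_add_distrib]
    exact Finset.sum_congr rfl fun i hi => (hF i hi).eq t ht

theorem const_mul (c : ℂ) (hF : DeltaAC X t₀ F D) :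
    DeltaAC X t₀ (fun t => c * F t) (fun t => c * D t) where
  integrable t ht := (hF.integrable t ht).const_mul c
  eq t ht := by rw [integral_const_mul, hF.eq t ht, mul_add]

theorem star (hF : DeltaAC X t₀ F D) :
    DeltaAC X t₀ (fun t => star (F t)) (fun t => star (D t)) where
  integrable t ht := by
    have := (hF.integrable t ht)
    refine ⟨Complex.continuous_conj.comp_aestronglyMeasurable this.1, ?_⟩
    exact this.2.congr' (Eventually.of_forall fun x => by simp)
  eq t ht := by
    rw [hF.eq t ht, star_add]
    congr 1
    exact integral_conj.symm

theorem congr (hF : DeltaAC X t₀ F D) {F' D' : ℝ → ℂ} (h : IsSturmian X t₀)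
    (h1 : ∀ t ∈ ray X t₀, F' t = F t) (h2 : ∀ t ∈ ray X t₀, D' t = D t) : DeltaAC X t₀ F' D' where
  integrable t ht := (hF.integrable t ht).congr
    (ae_restrict_of_ae (h.ae_mem_ray.mono fun s hs => (h2 s hs).symm))
  eq t ht := by
    rw [h1 t ht, h1 t₀ h.left_mem_ray, hF.eq t ht]
    congr 1
    exact integral_congr_ae (ae_restrict_of_ae (h.ae_mem_ray.mono fun s hs => (h2 s hs).symm))

/-- Up to a null set `[t₀, σ(t))` is `[t₀, t)` together with the point `t`, which has mass `μ(t)`.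
-/
theorem map_sigma (hF : DeltaAC X t₀ F D) (h : IsSturmian X t₀) {t : ℝ} (ht : t ∈ ray X t₀) :
    F (sigma X t) = F t + (mu X t : ℂ) * D t := by
  have hu : Icc t₀ t = Ico t₀ t ∪ {t} := by
    rw [union_singleton, Ico_insert_right (mem_Ici.1 ht.2)]
  have hi : IntegrableOn D (Icc t₀ t) (deltaMeasure X t₀) :=
    (hF.integrable _ (h.sigma_mem_ray ht)).congr_set_ae (h.Ico_sigma_ae_eq ht).symm
  rw [hF.eq _ (h.sigma_mem_ray ht), setIntegral_congr_set (h.Ico_sigma_ae_eq ht), hF.eq t ht, hu,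
    setIntegral_union (by simp) (measurableSet_singleton t) (hF.integrable t ht)
      (hi.mono_set (by rw [hu]; exact subset_union_right)),
    integral_singleton, Measure.real, h.deltaMeasure_singleton ht,
    ENNReal.toReal_ofReal (by rw [mu]; linarith [h.le_sigma t]), Complex.real_smul, add_assoc]

theorem of_hasDeltaDeriv (h : IsSturmian X t₀) (hD : ContinuousOn D (ray X t₀))
    (hF : ∀ t ∈ ray X t₀, HasDeltaDeriv X t₀ F (D t) t) : DeltaAC X t₀ F D where
  integrable _ ht := h.integrableOn_Ico hD ht
  eq _ ht := h.integral_deriv_eq_sub hD hF ht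

/-- The product rule `(F G)^Δ = F^Δ G^σ + F G^Δ`. -/
theorem mul (h : IsSturmian X t₀) (hF : DeltaAC X t₀ F D) (hG : DeltaAC X t₀ G E) :
    DeltaAC X t₀ (fun t => F t * G t) (fun t => D t * G (sigma X t) + F t * E t) := by
  have key : ∀ t ∈ ray X t₀,
      IntegrableOn (fun s => D s * G (sigma X s) + F s * E s) (Ico t₀ t) (deltaMeasure X t₀) ∧
      F t * G t = F t₀ * G t₀ +
        ∫ s in Ico t₀ t, (D s * G (sigma X s) + F s * E s) ∂deltaMeasure X t₀ := by
    intro t ht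
    set ν := (deltaMeasure X t₀).restrict (Ico t₀ t) with hν
    have hD := hF.integrable t ht
    have hE := hG.integrable t ht
    rw [IntegrableOn, ← hν] at hD hE
    obtain ⟨i1, i2, hprod⟩ := integral_mul_integral hD hE
    -- `G^σ` integrates over the closed triangle and `F` over the open one, matching the two parts
    -- of `integral_mul_integral`.
    have hae : (fun s => D s * G (sigma X s) + F s * E s) =ᵐ[ν]
        fun s => (D s * G t₀ + F t₀ * E s) +
          (D s * ∫ r in Iic s, E r ∂ν + (∫ r in Iio s, D r ∂ν) * E s) := by
      filter_upwards [ae_restrict_mem measurableSet_Ico, ae_restrict_of_ae h.ae_mem_ray]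
        with s hs hsr
      have e1 : G (sigma X s) = G t₀ + ∫ r in Iic s, E r ∂ν := by
        rw [hG.eq _ (h.sigma_mem_ray hsr), setIntegral_congr_set (h.Ico_sigma_ae_eq hsr), hν,
          Measure.restrict_restrict measurableSet_Iic]
        congr 3
        ext r
        simp only [mem_Icc, mem_inter_iff, mem_Iic, mem_Ico]
        exact ⟨fun h1 => ⟨h1.2, h1.1, h1.2.trans_lt hs.2⟩, fun h1 => ⟨h1.2.1, h1.1⟩⟩
      have e2 : F s = F t₀ + ∫ r in Iio s, D r ∂ν := by
        rw [hF.eq _ hsr, hν, Measure.restrict_restrict measurableSet_Iio]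
        congr 3
        ext r
        simp only [mem_inter_iff, mem_Iio, mem_Ico]
        exact ⟨fun h1 => ⟨h1.2, h1.1, h1.2.trans hs.2⟩, fun h1 => ⟨h1.2.1, h1.1⟩⟩
      rw [e1, e2]; ring
    have j1 := hD.mul_const (G t₀)
    have j2 := hE.const_mul (F t₀)
    have j3 : Integrable (fun s => D s * G t₀ + F t₀ * E s) ν := j1.add j2
    have i3 : Integrable (fun s => D s * ∫ r in Iic s, E r ∂ν + (∫ r in Iio s, D r ∂ν) * E s) ν :=
      i1.add i2
    refine ⟨(j3.add i3).congr hae.symm, ?_⟩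
    rw [integral_congr_ae hae, integral_add j3 i3, integral_add j1 j2,
      integral_add i1 i2, ← hprod, integral_mul_const, integral_const_mul, hF.eq t ht, hG.eq t ht]
    ring
  exact ⟨fun t ht => (key t ht).1, fun t ht => (key t ht).2⟩

end DeltaAC

/-! ### Matrix functions and half-shifts -/

/-- Entrywise `DeltaAC`. -/
def MatrixAC {m k : Type*} (X : Set ℝ) (t₀ : ℝ) (F D : ℝ → Matrix m k ℂ) : Prop :=
  ∀ i j, DeltaAC X t₀ (fun t => F t i j) (fun t => D t i j)

namespace MatrixAC

variable {X : Set ℝ} {t₀ : ℝ} {m k l : Type*}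

theorem conjTranspose {F D : ℝ → Matrix m k ℂ} (hF : MatrixAC X t₀ F D) :
    MatrixAC X t₀ (fun t => (F t)ᴴ) (fun t => (D t)ᴴ) := fun i j => (hF j i).star

theorem add {F D G E : ℝ → Matrix m k ℂ} (hF : MatrixAC X t₀ F D) (hG : MatrixAC X t₀ G E) :
    MatrixAC X t₀ (fun t => F t + G t) (fun t => D t + E t) := fun i j => (hF i j).add (hG i j)

theorem const_mul [Fintype m] (C : Matrix l m ℂ) {F D : ℝ → Matrix m k ℂ}
    (hF : MatrixAC X t₀ F D) : MatrixAC X t₀ (fun t => C * F t) (fun t => C * D t) :=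
  fun i j => DeltaAC.sum _ fun a _ => (hF a j).const_mul (C i a)

theorem submatrix {m' k' : Type*} (f : m' → m) (g : k' → k) {F D : ℝ → Matrix m k ℂ}
    (hF : MatrixAC X t₀ F D) :
    MatrixAC X t₀ (fun t => (F t).submatrix f g) (fun t => (D t).submatrix f g) :=
  fun i j => hF (f i) (g j)

theorem map_sigma {F D : ℝ → Matrix m k ℂ} (hF : MatrixAC X t₀ F D) (h : IsSturmian X t₀) {t : ℝ}
    (ht : t ∈ ray X t₀) : F (sigma X t) = F t + (mu X t : ℂ) • D t := by
  ext i j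
  exact (hF i j).map_sigma h ht

theorem congr {F D F' D' : ℝ → Matrix m k ℂ} (hF : MatrixAC X t₀ F D) (h : IsSturmian X t₀)
    (h1 : ∀ t ∈ ray X t₀, F' t = F t) (h2 : ∀ t ∈ ray X t₀, D' t = D t) : MatrixAC X t₀ F' D' :=
  fun i j => (hF i j).congr h (fun t ht => by rw [h1 t ht]) (fun t ht => by rw [h2 t ht])

theorem mul [Fintype k] {F D : ℝ → Matrix m k ℂ} {G E : ℝ → Matrix k l ℂ} (h : IsSturmian X t₀)
    (hF : MatrixAC X t₀ F D) (hG : MatrixAC X t₀ G E) :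
    MatrixAC X t₀ (fun t => F t * G t) (fun t => D t * G (sigma X t) + F t * E t) := fun i j => by
  simp only [Matrix.add_apply, Matrix.mul_apply, ← Finset.sum_add_distrib]
  exact DeltaAC.sum _ fun a _ => (hF i a).mul h (hG a j)

/-- Both forms equal `D G + F E + μ D E`, so the shift can be moved to the other factor. -/
theorem mul' [Fintype k] {F D : ℝ → Matrix m k ℂ} {G E : ℝ → Matrix k l ℂ} (h : IsSturmian X t₀)
    (hF : MatrixAC X t₀ F D) (hG : MatrixAC X t₀ G E) :
    MatrixAC X t₀ (fun t => F t * G t) (fun t => D t * G t + F (sigma X t) * E t) := by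
  refine (mul h hF hG).congr h (fun _ _ => rfl) fun t ht => ?_
  rw [hF.map_sigma h ht, hG.map_sigma h ht]
  simp only [Matrix.add_mul, Matrix.mul_add, Matrix.mul_smul, Matrix.smul_mul]
  abel

end MatrixAC
end TimeScale

/-- The vector with upper half taken from `F t` and lower half from `F (σ t)`. -/
def TimeScale.halfShift {n : ℕ} {m : Type*} (X : Set ℝ) (F : ℝ → Matrix (Fin n ⊕ Fin n) m ℂ)
    (t : ℝ) : Matrix (Fin n ⊕ Fin n) m ℂ :=
  fromRows (F t).toRows₁ (F (sigma X t)).toRows₂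

theorem conjTranspose_mul_fromBlocks_antidiagonal_mul {n m k : Type*} [Fintype n]
    (P Q : Matrix n n ℂ) (x : Matrix (n ⊕ n) m ℂ) (y : Matrix (n ⊕ n) k ℂ) :
    xᴴ * fromBlocks 0 P Q 0 * y =
      x.toRows₁ᴴ * (P * y.toRows₂) + x.toRows₂ᴴ * (Q * y.toRows₁) := by
  conv_lhs => rw [← fromRows_toRows x, ← fromRows_toRows y]
  rw [conjTranspose_fromRows_eq_fromCols_conjTranspose, fromCols_mul_fromBlocks,
    fromCols_mul_fromRows]
  simp only [Matrix.mul_zero, zero_add, add_zero, Matrix.mul_assoc]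
  exact add_comm _ _

/-- The product rule for `F* K G` with an off-diagonal weight `K`, in terms of half-shifts. -/
theorem TimeScale.MatrixAC.conjTranspose_mul_antidiagonal_mul {n : ℕ} {m k : Type*} {X : Set ℝ}
    {t₀ : ℝ} (h : IsSturmian X t₀) (P Q : Matrix (Fin n) (Fin n) ℂ)
    {F D : ℝ → Matrix (Fin n ⊕ Fin n) m ℂ} {G E : ℝ → Matrix (Fin n ⊕ Fin n) k ℂ}
    (hF : MatrixAC X t₀ F D) (hG : MatrixAC X t₀ G E) :
    MatrixAC X t₀ (fun t => (F t)ᴴ * fromBlocks 0 P Q 0 * G t)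
      (fun t => (D t)ᴴ * fromBlocks 0 P Q 0 * halfShift X G t
        + (halfShift X F t)ᴴ * fromBlocks 0 P Q 0 * E t) := by
  have hF1 : MatrixAC X t₀ (fun t => (F t).toRows₁) (fun t => (D t).toRows₁) :=
    hF.submatrix Sum.inl id
  have hF2 : MatrixAC X t₀ (fun t => (F t).toRows₂) (fun t => (D t).toRows₂) :=
    hF.submatrix Sum.inr id
  have hG1 : MatrixAC X t₀ (fun t => (G t).toRows₁) (fun t => (E t).toRows₁) :=
    hG.submatrix Sum.inl id
  have hG2 : MatrixAC X t₀ (fun t => (G t).toRows₂) (fun t => (E t).toRows₂) :=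
    hG.submatrix Sum.inr id
  -- An off-diagonal weight pairs an upper half with a lower half in each term. One product rule is
  -- used for each term so that the shift falls on the lower half both times; no graininess term is
  -- left over.
  refine ((hF1.conjTranspose.mul h (hG2.const_mul P)).add
    (hF2.conjTranspose.mul' h (hG1.const_mul Q))).congr h (fun t _ => ?_) (fun t _ => ?_)
  · rw [conjTranspose_mul_fromBlocks_antidiagonal_mul]
  · simp only [conjTranspose_mul_fromBlocks_antidiagonal_mul, halfShift, toRows₁_fromRows,
      toRows₂_fromRows]
    abel

/-! ### Coefficients, solutions as half-shifts, the Wronskian identity -/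

namespace HamSystem

variable {n : ℕ} (S : HamSystem n)

theorem isSturmian : IsSturmian S.X S.t₀ := ⟨S.isClosed_X, S.unbounded_X, S.t₀_mem, S.sturmian⟩

theorem posSemidef_A' {t : ℝ} (ht : t ∈ S.T) : (S.A t).PosSemidef := S.posSemidef_A t ht

theorem conjTranspose_A {t : ℝ} (ht : t ∈ S.T) : (S.A t)ᴴ = S.A t := (S.posSemidef_A' ht).1

theorem continuousOn_A : ContinuousOn S.A S.T := by
  have h := S.isSturmian
  have h1 := h.continuousOn_of_rdContinuous S.rd_A₁
  have h2 := h.continuousOn_of_rdContinuous S.rd_A₂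
  rw [continuousOn_iff_continuous_domRestrict] at *
  exact h1.matrix_fromBlocks continuous_const continuous_const h2

theorem continuousOn_B : ContinuousOn S.B S.T := by
  have h := S.isSturmian
  have h1 := h.continuousOn_of_rdContinuous S.rd_B₁
  have h2 := h.continuousOn_of_rdContinuous S.rd_B₂
  have h3 := h.continuousOn_of_rdContinuous S.rd_B₃
  have h4 := h.continuousOn_of_rdContinuous S.rd_B₄
  rw [continuousOn_iff_continuous_domRestrict] at *
  exact h1.matrix_fromBlocks h2 h3 h4

theorem continuousOn_μc : ContinuousOn S.μc S.T :=
  Complex.continuous_ofReal.comp_continuousOn S.isSturmian.continuousOn_mu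

theorem continuousOn_E₂ : ContinuousOn S.E₂ S.T := by
  intro t ht
  have h2 := S.isSturmian.continuousOn_of_rdContinuous S.rd_B₂ t ht
  have hmu := S.continuousOn_μc t ht
  have hc : ContinuousWithinAt (fun t => 1 + S.μc t • S.B₂ t) S.T t :=
    continuousWithinAt_const.add (hmu.smul h2)
  have hdet : IsUnit (1 + S.μc t • S.B₂ t).det :=
    (Matrix.isUnit_iff_isUnit_det _).1 (S.isUnit_B₂ t ht)
  have hi : ContinuousAt (Inv.inv : Matrix (Fin n) (Fin n) ℂ → _) (1 + S.μc t • S.B₂ t) := by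
    refine continuousAt_matrix_inv _ ?_
    obtain ⟨u, hu⟩ := hdet
    rw [← hu]
    exact NormedRing.inverse_continuousAt u
  exact ContinuousAt.comp_continuousWithinAt hi hc

theorem continuousOn_H (lam : ℂ) : ContinuousOn (S.H lam) S.T := by
  have h1 := S.isSturmian.continuousOn_of_rdContinuous S.rd_A₁
  have h2 := S.isSturmian.continuousOn_of_rdContinuous S.rd_B₁
  have h3 := S.continuousOn_E₂
  have h4 := S.continuousOn_μc
  rw [continuousOn_iff_continuous_domRestrict] at *
  exact continuous_const.matrix_fromBlocks continuous_const
    (h4.smul (h3.matrix_mul ((h1.const_smul lam).add h2))).neg h3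

theorem continuousOn_Htilde (lam : ℂ) : ContinuousOn (S.Htilde lam) S.T := by
  have h1 := S.isSturmian.continuousOn_of_rdContinuous S.rd_A₂
  have h2 := S.isSturmian.continuousOn_of_rdContinuous S.rd_B₄
  have h3 := S.continuousOn_E₂
  have h4 := S.continuousOn_μc
  rw [continuousOn_iff_continuous_domRestrict] at *
  exact h3.matrix_conjTranspose.matrix_fromBlocks
    (h4.smul (h3.matrix_conjTranspose.matrix_mul
      ((h1.const_smul (star lam)).add h2.matrix_conjTranspose))).neg
    continuous_const continuous_const

theorem continuousOn_N : ContinuousOn S.N S.T := by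
  have h3 := S.continuousOn_E₂
  have h4 := S.continuousOn_μc
  rw [continuousOn_iff_continuous_domRestrict] at *
  exact continuous_const.matrix_fromBlocks continuous_const (h4.smul h3).neg continuous_const

theorem one_add_mul_E₂ {t : ℝ} (ht : t ∈ S.T) : (1 + S.μc t • S.B₂ t) * S.E₂ t = 1 :=
  Matrix.mul_nonsing_inv _ ((Matrix.isUnit_iff_isUnit_det _).1 (S.isUnit_B₂ t ht))

theorem E₂_mul_one_add {t : ℝ} (ht : t ∈ S.T) : S.E₂ t * (1 + S.μc t • S.B₂ t) = 1 :=
  Matrix.nonsing_inv_mul _ ((Matrix.isUnit_iff_isUnit_det _).1 (S.isUnit_B₂ t ht))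

theorem J_mul_fromRows {k : Type*} (x y : Matrix (Fin n) k ℂ) :
    Matrix.J (Fin n) ℂ * fromRows x y = fromRows (-y) x := by
  rw [Matrix.J, fromBlocks_mul_fromRows]
  simp

theorem conjTranspose_J : (Matrix.J (Fin n) ℂ)ᴴ = -Matrix.J (Fin n) ℂ := by
  rw [Matrix.J, fromBlocks_conjTranspose]
  simp [fromBlocks_neg]

/-- If `J ŷ^Δ = (λ A + B) y + q` with `y = H ŷ + N q` at `t`, then `y` is the half-shift of `ŷ`. -/
theorem halfShift_eq_of_J_mul_eq {k : Type*} (lam : ℂ) {t : ℝ} (ht : t ∈ S.T)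
    {p d q : Matrix (Fin n ⊕ Fin n) k ℂ}
    (hd : Matrix.J (Fin n) ℂ * d = (lam • S.A t + S.B t) * (S.H lam t * p + S.N t * q) + q) :
    fromRows p.toRows₁ (p + S.μc t • d).toRows₂ = S.H lam t * p + S.N t * q := by
  obtain ⟨p1, p2, rfl⟩ : ∃ p1 p2, p = fromRows p1 p2 := ⟨_, _, (fromRows_toRows p).symm⟩
  obtain ⟨q1, q2, rfl⟩ : ∃ p1 p2, q = fromRows p1 p2 := ⟨_, _, (fromRows_toRows q).symm⟩
  obtain ⟨d1, d2, rfl⟩ : ∃ p1 p2, d = fromRows p1 p2 := ⟨_, _, (fromRows_toRows d).symm⟩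
  -- The shifted lower half `y2 = p2 + μ d2` satisfies an implicit equation, because `d2` contains
  -- `B₂ y2`; solving it is what `E₂` does in `H` and `N`.
  set y2 := S.E₂ t * (p2 - S.μc t • ((lam • S.A₁ t + S.B₁ t) * p1 + q1)) with hy2
  have hy : S.H lam t * fromRows p1 p2 + S.N t * fromRows q1 q2 = fromRows p1 y2 := by
    rw [H, N, fromBlocks_mul_fromRows, fromBlocks_mul_fromRows]
    ext i j
    rcases i with i | i
    · simp
    · simp only [hy2, Matrix.mul_sub, Matrix.mul_smul, Matrix.mul_add, Matrix.add_apply,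
        fromRows_apply_inr, Matrix.neg_mul, Matrix.smul_mul, Matrix.neg_apply, Matrix.smul_apply,
        Matrix.sub_apply, Matrix.mul_assoc, Matrix.zero_mul, Matrix.zero_apply, smul_add,
        Matrix.add_mul]
      ring
  rw [hy] at hd ⊢
  rw [J_mul_fromRows, A, B, fromBlocks_smul, fromBlocks_add, fromBlocks_mul_fromRows] at hd
  have h2 : d2 = -((lam • S.A₁ t + S.B₁ t) * p1 + S.B₂ t * y2 + q1) := by
    have := congrArg toRows₁ hd
    rw [← neg_eq_iff_eq_neg]
    ext i j
    have h3 := congrFun (congrFun this i) j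
    simpa using h3
  have h4 : (1 + S.μc t • S.B₂ t) * y2 =
      p2 - S.μc t • ((lam • S.A₁ t + S.B₁ t) * p1 + q1) := by
    rw [hy2, ← Matrix.mul_assoc, S.one_add_mul_E₂ ht, Matrix.one_mul]
  have h5 : p2 + S.μc t • d2 = y2 := by
    rw [Matrix.add_mul, Matrix.one_mul, Matrix.smul_mul] at h4
    rw [h2, ← sub_eq_zero]
    rw [← sub_eq_zero] at h4
    rw [← neg_eq_zero, ← h4]
    simp only [smul_neg, smul_add]
    abel
  rw [← h5]
  ext i j
  rcases i with i | i <;> simp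

/-- If `J ẑ^Δ = (λ̄ A + B*) z` with `z = H̃ ẑ^σ` at `t`, then `z` is the half-shift of `ẑ`. -/
theorem halfShift_eq_of_J_mul_eq_tilde {k : Type*} (lam : ℂ) {t : ℝ} (ht : t ∈ S.T)
    {p d r : Matrix (Fin n ⊕ Fin n) k ℂ} (hr : r = p + S.μc t • d)
    (hd : Matrix.J (Fin n) ℂ * d = (star lam • S.A t + (S.B t)ᴴ) * (S.Htilde lam t * r)) :
    fromRows p.toRows₁ r.toRows₂ = S.Htilde lam t * r := by
  obtain ⟨p1, p2, rfl⟩ : ∃ p1 p2, p = fromRows p1 p2 := ⟨_, _, (fromRows_toRows p).symm⟩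
  obtain ⟨r1, r2, rfl⟩ : ∃ p1 p2, r = fromRows p1 p2 := ⟨_, _, (fromRows_toRows r).symm⟩
  obtain ⟨d1, d2, rfl⟩ : ∃ p1 p2, d = fromRows p1 p2 := ⟨_, _, (fromRows_toRows d).symm⟩
  -- Here the upper half is stepped backwards: `r1 = p1 + μ d1` where `d1` contains `B₂* z1`, so
  -- inverting `1 + μ B₂*` recovers `p1`.
  set z1 := (S.E₂ t)ᴴ * (r1 - S.μc t • ((star lam • S.A₂ t + (S.B₄ t)ᴴ) * r2)) with hz1
  have hz : S.Htilde lam t * fromRows r1 r2 = fromRows z1 r2 := by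
    rw [Htilde, fromBlocks_mul_fromRows, hz1]
    congr 1
    · rw [Matrix.mul_sub, Matrix.mul_smul, Matrix.neg_mul, Matrix.smul_mul, Matrix.mul_assoc,
        sub_eq_add_neg]
    · simp
  rw [hz] at hd ⊢
  rw [J_mul_fromRows, A, B, fromBlocks_conjTranspose, fromBlocks_smul, fromBlocks_add,
    fromBlocks_mul_fromRows] at hd
  have h2 : d1 = (S.B₂ t)ᴴ * z1 + (star lam • S.A₂ t + (S.B₄ t)ᴴ) * r2 := by
    have := congrArg toRows₂ hd
    simpa using this
  have h1 : r1 = p1 + S.μc t • d1 := by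
    have := congrArg toRows₁ hr
    ext i j
    simpa using congrFun (congrFun this i) j
  have hmu : star (S.μc t) = S.μc t := Complex.conj_ofReal _
  have hE1 : (S.E₂ t)ᴴ * (1 + S.μc t • (S.B₂ t)ᴴ) = 1 := by
    have := congrArg conjTranspose (S.one_add_mul_E₂ ht)
    rwa [conjTranspose_mul, conjTranspose_add, conjTranspose_smul, conjTranspose_one, hmu] at this
  have hE2 : (1 + S.μc t • (S.B₂ t)ᴴ) * (S.E₂ t)ᴴ = 1 := by
    have := congrArg conjTranspose (S.E₂_mul_one_add ht)
    rwa [conjTranspose_mul, conjTranspose_add, conjTranspose_smul, conjTranspose_one, hmu] at this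
  have h5 : z1 = p1 := by
    have h6 : (1 + S.μc t • (S.B₂ t)ᴴ) * z1 = p1 + S.μc t • ((S.B₂ t)ᴴ * z1) := by
      conv_lhs => rw [hz1, ← Matrix.mul_assoc, hE2, Matrix.one_mul, h1, h2]
      rw [smul_add]
      abel
    rw [Matrix.add_mul, Matrix.one_mul, Matrix.smul_mul] at h6
    exact add_right_cancel h6
  rw [h5]
  simp

theorem continuousOn_of_hasMatrixDeltaDeriv {F D : ℝ → Mat n}
    (hF : ∀ t ∈ S.T, HasMatrixDeltaDeriv S.X S.t₀ F (D t) t) : ContinuousOn F S.T := by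
  refine continuousOn_pi.2 fun i => continuousOn_pi.2 fun j => ?_
  exact S.isSturmian.continuousOn_of_hasDeltaDeriv fun t ht => hF t ht i j

theorem matrixAC_of_hasMatrixDeltaDeriv {F D : ℝ → Mat n} (hD : ContinuousOn D S.T)
    (hF : ∀ t ∈ S.T, HasMatrixDeltaDeriv S.X S.t₀ F (D t) t) : MatrixAC S.X S.t₀ F D :=
  fun i j => DeltaAC.of_hasDeltaDeriv S.isSturmian
    (continuousOn_pi.1 (continuousOn_pi.1 hD i) j) fun t ht => hF t ht i j

variable {S} {lam : ℂ} {Yh Zh : ℝ → Mat n}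

theorem neg_J_mul_J_mul {k : Type*} (D : Matrix (Fin n ⊕ Fin n) k ℂ) :
    -(Matrix.J (Fin n) ℂ * (Matrix.J (Fin n) ℂ * D)) = D := by
  rw [← Matrix.mul_assoc, J_squared, Matrix.neg_mul, Matrix.one_mul, neg_neg]

theorem J_mul_neg_J_mul {k : Type*} (D : Matrix (Fin n ⊕ Fin n) k ℂ) :
    Matrix.J (Fin n) ℂ * -(Matrix.J (Fin n) ℂ * D) = D := by
  rw [Matrix.mul_neg, neg_J_mul_J_mul]

/-- Since `J² = -1`, the equation can be solved for the derivative. The resulting formula is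
continuous once `Y` is, which opens the way to `DeltaAC.of_hasDeltaDeriv`. -/
theorem IsFundamental.hasDeriv (hY : S.IsFundamental lam Yh) {t : ℝ} (ht : t ∈ S.T) :
    HasMatrixDeltaDeriv S.X S.t₀ Yh
      (-(Matrix.J (Fin n) ℂ * ((lam • S.A t + S.B t) * S.Y lam Yh t))) t := by
  obtain ⟨D, hD, hJ⟩ := hY.2 t ht
  rw [Matrix.mul_assoc] at hJ
  rwa [Y, ← hJ, neg_J_mul_J_mul]

theorem IsFundamental.continuousOn_Y (hY : S.IsFundamental lam Yh) :
    ContinuousOn (S.Y lam Yh) S.T := by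
  have h1 := S.continuousOn_of_hasMatrixDeltaDeriv fun t ht => hY.hasDeriv ht
  have h2 := S.continuousOn_H lam
  rw [continuousOn_iff_continuous_domRestrict] at *
  exact h2.matrix_mul h1

theorem IsFundamental.matrixAC (hY : S.IsFundamental lam Yh) :
    MatrixAC S.X S.t₀ Yh
      (fun t => -(Matrix.J (Fin n) ℂ * ((lam • S.A t + S.B t) * S.Y lam Yh t))) := by
  refine S.matrixAC_of_hasMatrixDeltaDeriv ?_ fun t ht => hY.hasDeriv ht
  have h1 := hY.continuousOn_Y
  have h2 := S.continuousOn_A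
  have h3 := S.continuousOn_B
  rw [continuousOn_iff_continuous_domRestrict] at *
  exact (continuous_const.matrix_mul (((h2.const_smul lam).add h3).matrix_mul h1)).neg

theorem IsFundamental.halfShift_eq (hY : S.IsFundamental lam Yh) {t : ℝ} (ht : t ∈ S.T) :
    halfShift S.X Yh t = S.Y lam Yh t := by
  rw [halfShift, hY.matrixAC.map_sigma S.isSturmian ht]
  have := S.halfShift_eq_of_J_mul_eq lam ht (p := Yh t) (q := 0)
    (d := -(Matrix.J (Fin n) ℂ * ((lam • S.A t + S.B t) * S.Y lam Yh t))) (by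
      rw [J_mul_neg_J_mul]; simp [Y])
  simpa [Y, μc] using this

theorem IsAdjointFundamental.hasDeriv (hZ : S.IsAdjointFundamental lam Zh) {t : ℝ} (ht : t ∈ S.T) :
    HasMatrixDeltaDeriv S.X S.t₀ Zh
      (-(Matrix.J (Fin n) ℂ * ((star lam • S.A t + (S.B t)ᴴ) * S.Z lam Zh t))) t := by
  obtain ⟨D, hD, hJ⟩ := hZ.2 t ht
  rw [Matrix.mul_assoc] at hJ
  rwa [Z, ← hJ, neg_J_mul_J_mul]

theorem IsAdjointFundamental.continuousOn_Z (hZ : S.IsAdjointFundamental lam Zh) :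
    ContinuousOn (S.Z lam Zh) S.T := by
  have h1 := (S.continuousOn_of_hasMatrixDeltaDeriv fun t ht => hZ.hasDeriv ht).comp
    S.isSturmian.continuousOn_sigma fun t ht => S.isSturmian.sigma_mem_ray ht
  have h2 := S.continuousOn_Htilde lam
  rw [continuousOn_iff_continuous_domRestrict] at *
  exact h2.matrix_mul h1

theorem IsAdjointFundamental.matrixAC (hZ : S.IsAdjointFundamental lam Zh) :
    MatrixAC S.X S.t₀ Zh
      (fun t => -(Matrix.J (Fin n) ℂ * ((star lam • S.A t + (S.B t)ᴴ) * S.Z lam Zh t))) := by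
  refine S.matrixAC_of_hasMatrixDeltaDeriv ?_ fun t ht => hZ.hasDeriv ht
  have h1 := hZ.continuousOn_Z
  have h2 := S.continuousOn_A
  have h3 := S.continuousOn_B
  rw [continuousOn_iff_continuous_domRestrict] at *
  exact (continuous_const.matrix_mul
    (((h2.const_smul (star lam)).add h3.matrix_conjTranspose).matrix_mul h1)).neg

theorem IsAdjointFundamental.halfShift_eq (hZ : S.IsAdjointFundamental lam Zh) {t : ℝ}
    (ht : t ∈ S.T) : halfShift S.X Zh t = S.Z lam Zh t :=
  S.halfShift_eq_of_J_mul_eq_tilde lam ht (hZ.matrixAC.map_sigma S.isSturmian ht)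
    (J_mul_neg_J_mul _)

/-- The Wronskian identity `Ẑ* J Ŷ = J`. -/
theorem IsFundamental.wronskian (hY : S.IsFundamental lam Yh) (hZ : S.IsAdjointFundamental lam Zh)
    {t : ℝ} (ht : t ∈ S.T) :
    (Zh t)ᴴ * Matrix.J (Fin n) ℂ * Yh t = Matrix.J (Fin n) ℂ := by
  have h1 := (MatrixAC.conjTranspose_mul_antidiagonal_mul S.isSturmian (-1) 1 hZ.matrixAC
    hY.matrixAC).congr S.isSturmian (F' := fun t => (Zh t)ᴴ * Matrix.J (Fin n) ℂ * Yh t)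
    (D' := fun t => 0) (fun _ _ => rfl) (fun t ht => by
      -- The two terms of the product rule cancel because `λ̄ A + B*` is the adjoint of `λ A + B`.
      change 0 = _ᴴ * Matrix.J (Fin n) ℂ * _ + _ᴴ * Matrix.J (Fin n) ℂ * _
      rw [hY.halfShift_eq ht, hZ.halfShift_eq ht, Matrix.mul_assoc _ (Matrix.J _ _) (-_),
        J_mul_neg_J_mul, conjTranspose_neg, conjTranspose_mul, conjTranspose_J,
        conjTranspose_mul, conjTranspose_add, conjTranspose_smul, conjTranspose_conjTranspose,
        star_star, S.conjTranspose_A ht, Matrix.mul_neg, neg_neg,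
        Matrix.mul_assoc _ (Matrix.J _ _) (Matrix.J _ _), J_squared]
      simp only [Matrix.mul_neg, Matrix.mul_one, Matrix.neg_mul, Matrix.mul_assoc,
        neg_add_cancel])
  ext i j
  have h2 := (h1 i j).eq t ht
  have h3 : (Zh S.t₀)ᴴ * Matrix.J (Fin n) ℂ * Yh S.t₀ = Matrix.J (Fin n) ℂ := by
    rw [hY.1, hZ.1, conjTranspose_J, Matrix.neg_mul, J_squared, neg_neg, Matrix.one_mul]
  simpa [h3] using h2

/-- By the Wronskian identity `-J Ẑ* J` is a left inverse of the square matrix `Ŷ`, hence a right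
inverse. This order of the factors is the one needed in variation of constants. -/
theorem IsFundamental.wronskian' (hY : S.IsFundamental lam Yh)
    (hZ : S.IsAdjointFundamental lam Zh) {t : ℝ} (ht : t ∈ S.T) :
    Yh t * Matrix.J (Fin n) ℂ * (Zh t)ᴴ = Matrix.J (Fin n) ℂ := by
  have h1 := hY.wronskian hZ ht
  have h2 : (-(Matrix.J (Fin n) ℂ * (Zh t)ᴴ * Matrix.J (Fin n) ℂ)) * Yh t = 1 := by
    rw [Matrix.neg_mul, Matrix.mul_assoc, Matrix.mul_assoc, ← Matrix.mul_assoc _ _ (Yh t), h1,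
      J_squared, neg_neg]
  have h3 := mul_eq_one_comm.1 h2
  have h4 := congrArg (fun K => K * Matrix.J (Fin n) ℂ) h3
  simp only [Matrix.mul_neg, Matrix.neg_mul, Matrix.mul_assoc, J_squared, Matrix.mul_one,
    neg_neg, Matrix.one_mul] at h4
  rw [Matrix.mul_assoc, h4]

end HamSystem

/-! ### Sesquilinear forms -/

section Sesq

variable {m k l : Type*} [Fintype m] [Fintype k] [Fintype l]

/-- The sesquilinear form `x* K y`. -/
def sesq (K : Matrix m k ℂ) (x : m → ℂ) (y : k → ℂ) : ℂ := star x ⬝ᵥ (K *ᵥ y)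

theorem sesq_add_left (K : Matrix m k ℂ) (x x' : m → ℂ) (y : k → ℂ) :
    sesq K (x + x') y = sesq K x y + sesq K x' y := by simp [sesq, add_dotProduct]

theorem sesq_add_right (K : Matrix m k ℂ) (x : m → ℂ) (y y' : k → ℂ) :
    sesq K x (y + y') = sesq K x y + sesq K x y' := by simp [sesq, mulVec_add, dotProduct_add]

theorem sesq_smul_left (K : Matrix m k ℂ) (c : ℂ) (x : m → ℂ) (y : k → ℂ) :
    sesq K (c • x) y = star c * sesq K x y := by simp [sesq]

theorem sesq_smul_right (K : Matrix m k ℂ) (c : ℂ) (x : m → ℂ) (y : k → ℂ) :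
    sesq K x (c • y) = c * sesq K x y := by simp [sesq, mulVec_smul]

theorem sesq_mulVec_right (K : Matrix m k ℂ) (L : Matrix k l ℂ) (x : m → ℂ) (y : l → ℂ) :
    sesq K x (L *ᵥ y) = sesq (K * L) x y := by simp [sesq]

theorem sesq_mulVec_left (K : Matrix m k ℂ) (L : Matrix m l ℂ) (x : l → ℂ) (y : k → ℂ) :
    sesq K (L *ᵥ x) y = sesq (Lᴴ * K) x y := by
  rw [sesq, sesq, star_mulVec, ← dotProduct_mulVec, mulVec_mulVec]

theorem star_sesq (K : Matrix m k ℂ) (x : m → ℂ) (y : k → ℂ) :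
    star (sesq K x y) = sesq Kᴴ y x := by
  rw [sesq, sesq, ← star_dotProduct_star, star_star, star_mulVec, ← dotProduct_mulVec]

theorem re_sesq_conjTranspose (K : Matrix m m ℂ) (x : m → ℂ) :
    (sesq Kᴴ x x).re = (sesq K x x).re := by
  rw [← star_sesq]; exact Complex.conj_re _

theorem sesq_add_matrix (K L : Matrix m k ℂ) (x : m → ℂ) (y : k → ℂ) :
    sesq (K + L) x y = sesq K x y + sesq L x y := by
  simp [sesq, add_mulVec, dotProduct_add]

theorem sesq_sub_matrix (K L : Matrix m k ℂ) (x : m → ℂ) (y : k → ℂ) :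
    sesq (K - L) x y = sesq K x y - sesq L x y := by
  simp [sesq, sub_mulVec, dotProduct_sub]

theorem sesq_neg_matrix (K : Matrix m k ℂ) (x : m → ℂ) (y : k → ℂ) :
    sesq (-K) x y = -sesq K x y := by
  simp [sesq, neg_mulVec, dotProduct_neg]

theorem sesq_smul_matrix (c : ℂ) (K : Matrix m k ℂ) (x : m → ℂ) (y : k → ℂ) :
    sesq (c • K) x y = c * sesq K x y := by
  simp [sesq, smul_mulVec, dotProduct_smul]

theorem re_sesq_matRe (K : Matrix m m ℂ) (x : m → ℂ) :
    (sesq (matRe K) x x).re = (sesq K x x).re := by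
  have h1 : (1 / 2 : ℂ) * ((2 * (sesq K x x).re : ℝ) : ℂ) = ((sesq K x x).re : ℂ) := by
    push_cast
    ring
  rw [matRe, sesq_smul_matrix, sesq_add_matrix, ← star_sesq, Complex.star_def, Complex.add_conj,
    h1, Complex.ofReal_re]

theorem Matrix.PosSemidef.re_sesq_nonneg {K : Matrix m m ℂ} (hK : K.PosSemidef)
    (x : m → ℂ) : 0 ≤ (sesq K x x).re :=
  (Complex.le_def.1 (hK.dotProduct_mulVec_nonneg x)).1

/-- Expand `K` at `2 ε x + y` and divide by `4 ε`. This is the source of the constant `1 / (4 ε)` in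
the final estimate. -/
theorem Matrix.PosSemidef.neg_re_sesq_le {K : Matrix m m ℂ} (hK : K.PosSemidef)
    {ε : ℝ} (hε : 0 < ε) (x y : m → ℂ) :
    -(sesq K x y).re ≤ ε * (sesq K x x).re + 1 / (4 * ε) * (sesq K y y).re := by
  have h1 := hK.re_sesq_nonneg (((2 * ε : ℝ) : ℂ) • x + y)
  have h2 : (sesq K y x).re = (sesq K x y).re := by
    have := star_sesq K x y
    rw [hK.1] at this
    rw [← this]; exact Complex.conj_re _
  rw [sesq_add_left, sesq_add_right, sesq_add_right, sesq_smul_left, sesq_smul_left,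
    sesq_smul_right, sesq_smul_right] at h1
  simp only [Complex.star_def, Complex.conj_ofReal, Complex.add_re, Complex.re_ofReal_mul, h2]
    at h1
  have h3 : 0 ≤ (4 * ε) * (ε * (sesq K x x).re + 1 / (4 * ε) * (sesq K y y).re + (sesq K x y).re) := by
    have : (4 * ε) * (ε * (sesq K x x).re + 1 / (4 * ε) * (sesq K y y).re + (sesq K x y).re) =
        4 * ε ^ 2 * (sesq K x x).re + (sesq K y y).re + 4 * ε * (sesq K x y).re := by
      field_simp
    rw [this]; linarith
  have h4 := nonneg_of_mul_nonneg_right h3 (by positivity)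
  linarith

/-- Multiplying `y` by a unimodular constant makes `x* K y` real and negative, and the case `ε = 1`
of the preceding inequality applies. It turns finiteness of two `L²_A` norms into integrability of
the pairing. -/
theorem Matrix.PosSemidef.norm_sesq_le {K : Matrix m m ℂ} (hK : K.PosSemidef)
    (x y : m → ℂ) : ‖sesq K x y‖ ≤ (sesq K x x).re + (sesq K y y).re := by
  obtain ⟨c, hc, hcs⟩ : ∃ c : ℂ, ‖c‖ = 1 ∧ c * sesq K x y = ‖sesq K x y‖ := by
    by_cases h0 : sesq K x y = 0
    · exact ⟨1, by simp, by simp [h0]⟩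
    · refine ⟨‖sesq K x y‖ / sesq K x y, by simp [h0], by field_simp⟩
  have h1 := hK.neg_re_sesq_le (ε := 1) one_pos x ((-c) • y)
  rw [sesq_smul_right, sesq_smul_left, sesq_smul_right, neg_mul, hcs, ← mul_assoc] at h1
  have h2 : star (-c) * -c = 1 := by
    rw [star_neg, neg_mul_neg, Complex.star_def, mul_comm, Complex.mul_conj, Complex.normSq_eq_norm_sq, hc]
    simp
  rw [h2] at h1
  simp only [one_mul, Complex.neg_re, Complex.ofReal_re, neg_neg] at h1
  have := hK.re_sesq_nonneg y
  linarith

theorem Matrix.PosSemidef.re_sesq_sub_le {K : Matrix m m ℂ} (hK : K.PosSemidef)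
    (x y : m → ℂ) : (sesq K (x - y) (x - y)).re ≤ 2 * (sesq K x x).re + 2 * (sesq K y y).re := by
  have h1 := hK.re_sesq_nonneg (x + y)
  rw [sub_eq_add_neg, ← neg_one_smul ℂ y]
  simp only [sesq_add_left, sesq_add_right, sesq_smul_left, sesq_smul_right] at h1 ⊢
  simp only [star_neg, star_one, Complex.add_re, neg_mul, one_mul, Complex.neg_re] at h1 ⊢
  linarith

end Sesq

/-! ### Duality of nonpositive subspaces and the energy identity -/

namespace HamSystem

variable {n : ℕ}

theorem U2_mul_U2_inv {U : Matrix (Fin n) (Fin n) ℂ} (hU : IsUnit U) : U2 U * U2 U⁻¹ = 1 := by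
  have h1 : U * U⁻¹ = 1 := Matrix.mul_nonsing_inv _ ((Matrix.isUnit_iff_isUnit_det _).1 hU)
  have h2 : U⁻¹ * U = 1 := Matrix.nonsing_inv_mul _ ((Matrix.isUnit_iff_isUnit_det _).1 hU)
  have h3 : Uᴴ * (U⁻¹)ᴴ = 1 := by rw [← conjTranspose_mul, h2, conjTranspose_one]
  rw [U2, U2, fromBlocks_multiply]
  simp only [Matrix.mul_zero, Matrix.zero_mul, add_zero, zero_add, h1, Matrix.neg_mul,
    Matrix.mul_neg, neg_neg, h3, neg_zero, fromBlocks_one]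

theorem U2_inv_mul_U2 {U : Matrix (Fin n) (Fin n) ℂ} (hU : IsUnit U) : U2 U⁻¹ * U2 U = 1 :=
  mul_eq_one_comm.1 (U2_mul_U2_inv hU)

theorem U2_mul_J (U : Matrix (Fin n) (Fin n) ℂ) :
    U2 U * Matrix.J (Fin n) ℂ = fromBlocks 0 (-U) (-Uᴴ) 0 := by
  rw [U2, Matrix.J, fromBlocks_multiply]
  simp

theorem conjTranspose_U2_mul_J (U : Matrix (Fin n) (Fin n) ℂ) :
    (U2 U * Matrix.J (Fin n) ℂ)ᴴ = U2 U * Matrix.J (Fin n) ℂ := by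
  rw [U2_mul_J, fromBlocks_conjTranspose]
  simp

/-- For invertible `U` the vectors `(x, -U* x)` thus form an `n`-dimensional positive subspace,
which limits nonpositive subspaces to dimension `n`. -/
theorem re_sesq_U2_mul_J (U : Matrix (Fin n) (Fin n) ℂ) (x : Fin n → ℂ) :
    (sesq (U2 U * Matrix.J (Fin n) ℂ) (Sum.elim x (-(Uᴴ *ᵥ x))) (Sum.elim x (-(Uᴴ *ᵥ x)))).re
      = 2 * (star (Uᴴ *ᵥ x) ⬝ᵥ (Uᴴ *ᵥ x)).re := by
  have h1 : star x ⬝ᵥ (U *ᵥ (Uᴴ *ᵥ x)) = star (Uᴴ *ᵥ x) ⬝ᵥ (Uᴴ *ᵥ x) := by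
    rw [star_mulVec, conjTranspose_conjTranspose, ← dotProduct_mulVec]
  have h2 : star (Sum.elim x (-(Uᴴ *ᵥ x))) = Sum.elim (star x) (-star (Uᴴ *ᵥ x)) := by
    ext i; rcases i with i | i <;> simp
  rw [sesq, U2_mul_J, fromBlocks_mulVec, h2, sumElim_dotProduct_sumElim]
  simp only [Sum.elim_comp_inl, Sum.elim_comp_inr, zero_mulVec, zero_add, neg_mulVec,
    mulVec_neg, neg_neg, h1, Complex.add_re]
  rw [neg_zero, add_zero, neg_dotProduct, dotProduct_neg, neg_neg]
  ring

/-- The matrix `(1; M)`. -/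
def graphCols (M : Matrix (Fin n) (Fin n) ℂ) : Matrix (Fin n ⊕ Fin n) (Fin n) ℂ := fromRows 1 M

/-- If the columns of `Ŷ (1; M)` span a nonpositive subspace for `𝒰₂ₙ J`, then those of
`Ẑ (1; M*)` span a nonpositive subspace for `𝒰₂ₙ⁻¹ J`. -/
theorem re_sesq_dual_nonpos {U : Matrix (Fin n) (Fin n) ℂ} (hU : IsUnit U) {Y Z : Mat n}
    (hZY : Zᴴ * Matrix.J (Fin n) ℂ * Y = Matrix.J (Fin n) ℂ) {M : Matrix (Fin n) (Fin n) ℂ}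
    (hM : ∀ c : Fin n → ℂ, (sesq (U2 U * Matrix.J (Fin n) ℂ) ((Y * graphCols M) *ᵥ c)
      ((Y * graphCols M) *ᵥ c)).re ≤ 0) (v : Fin n → ℂ) :
    (sesq (U2 U⁻¹ * Matrix.J (Fin n) ℂ) ((Z * graphCols Mᴴ) *ᵥ v)
      ((Z * graphCols Mᴴ) *ᵥ v)).re ≤ 0 := by
  set J := Matrix.J (Fin n) ℂ with hJ
  have hJJ : J * J = -1 := J_squared _ _
  have hJs : Jᴴ = -J := conjTranspose_J
  set z := (Z * graphCols Mᴴ) *ᵥ v with hz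
  set ψ : Matrix (Fin n ⊕ Fin n) (Fin n) ℂ := Y * graphCols M with hψ
  -- Chosen so that `𝒰₂ₙ J w = -J z`. Pairing `w` with the columns of `ψ` then gives the Wronskian
  -- of `z` and `ψ`, which vanishes, and the form at `w` is minus the dual form at `z`.
  set w := (J * U2 U⁻¹ * J) *ᵥ z with hw
  by_contra! hpos
  have hPw : (U2 U * J) * (J * U2 U⁻¹ * J) = -J := by
    calc (U2 U * J) * (J * U2 U⁻¹ * J) = U2 U * (J * J) * U2 U⁻¹ * J := by
          simp only [Matrix.mul_assoc]
      _ = -J := by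
          rw [hJJ, Matrix.mul_neg, Matrix.mul_one, Matrix.neg_mul, U2_mul_U2_inv hU,
            Matrix.neg_mul, Matrix.one_mul]
  have hcross : ∀ c, sesq (U2 U * J) w (ψ *ᵥ c) = 0 := by
    intro c
    have h1 : (J * U2 U⁻¹ * J)ᴴ * (U2 U * J) = J := by
      have := congrArg conjTranspose hPw
      rwa [conjTranspose_mul, conjTranspose_U2_mul_J, conjTranspose_neg, hJs, neg_neg] at this
    have h2 : (Z * graphCols Mᴴ)ᴴ * (J * ψ) = 0 := by
      rw [conjTranspose_mul, graphCols, conjTranspose_fromRows_eq_fromCols_conjTranspose, hψ, graphCols,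
        Matrix.mul_assoc, ← Matrix.mul_assoc J, ← Matrix.mul_assoc Zᴴ, ← Matrix.mul_assoc Zᴴ, hZY,
        J_mul_fromRows, fromCols_mul_fromRows]
      simp
    rw [hw, sesq_mulVec_left, h1, hz, sesq_mulVec_left, sesq_mulVec_right, Matrix.mul_assoc, h2]
    simp [sesq]
  have hneg : (sesq (U2 U * J) w w).re < 0 := by
    have h1 : sesq (U2 U * J) w w = -sesq (U2 U⁻¹ * J) z z := by
      have h3 : (J * U2 U⁻¹ * J)ᴴ * -J = -(U2 U⁻¹ * J) := by
        rw [Matrix.mul_assoc, conjTranspose_mul, conjTranspose_U2_mul_J, hJs, ← hJ]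
        simp only [Matrix.mul_neg, Matrix.neg_mul, neg_neg]
        rw [Matrix.mul_assoc (U2 U⁻¹) J J, hJJ, Matrix.mul_neg, Matrix.mul_one, Matrix.neg_mul]
      conv_lhs => rw [hw, sesq_mulVec_right, hPw, sesq_mulVec_left, h3]
      rw [sesq_neg_matrix]
    rw [h1, Complex.neg_re]; linarith
  have hcross' : ∀ c, sesq (U2 U * J) (ψ *ᵥ c) w = 0 := by
    intro c
    have := star_sesq (U2 U * J) w (ψ *ᵥ c)
    rwa [hcross, star_zero, conjTranspose_U2_mul_J, eq_comm] at this
  -- If the dual form were positive at `z`, then `w` and the columns of `ψ` would span a nonpositive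
  -- subspace of dimension `n + 1`. There are `2n + 1` unknowns in a space of dimension `2n`, so it
  -- meets the positive subspace nontrivially.
  let f : ((Fin n → ℂ) × ℂ × (Fin n → ℂ)) →ₗ[ℂ] Vec n :=
    { toFun := fun p => ψ *ᵥ p.1 + p.2.1 • w - Sum.elim p.2.2 (-(Uᴴ *ᵥ p.2.2))
      map_add' := fun p q => by
        ext i
        rcases i with i | i <;> simp [mulVec_add, add_smul] <;> ring
      map_smul' := fun a p => by
        ext i
        rcases i with i | i <;> simp [mulVec_smul, mul_smul] <;> ring }
  have hker : LinearMap.ker f ≠ ⊥ := by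
    apply LinearMap.ker_ne_bot_of_finrank_lt
    simp
  obtain ⟨⟨c, a, x⟩, hp, hp0⟩ := (Submodule.ne_bot_iff _).1 hker
  have hp1 : ψ *ᵥ c + a • w = Sum.elim x (-(Uᴴ *ᵥ x)) := sub_eq_zero.1 hp
  have h1 := re_sesq_U2_mul_J U x
  rw [← hp1] at h1
  simp only [sesq_add_left, sesq_add_right, sesq_smul_left, sesq_smul_right, ← hJ, hcross,
    hcross', mul_zero, add_zero, zero_add, ← mul_assoc] at h1
  rw [Complex.star_def, Complex.mul_conj, Complex.add_re, Complex.re_ofReal_mul]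
    at h1
  have h2 : 0 ≤ (star (Uᴴ *ᵥ x) ⬝ᵥ (Uᴴ *ᵥ x)).re :=
    (Complex.le_def.1 (dotProduct_star_self_nonneg (Uᴴ *ᵥ x))).1
  have h3 := hM c
  -- The form is at most zero on the left of `hp1` and at least zero on the right, with strict
  -- negativity if `a ≠ 0`.
  have ha : a = 0 := by
    by_contra ha
    have := Complex.normSq_pos.2 ha
    nlinarith
  subst ha
  simp only [Complex.normSq_zero, zero_mul, add_zero] at h1
  have h4 : (star (Uᴴ *ᵥ x) ⬝ᵥ (Uᴴ *ᵥ x)) = 0 :=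
    Complex.ext (by simp; linarith) (Complex.le_def.1 (dotProduct_star_self_nonneg (Uᴴ *ᵥ x))).2.symm
  have h5 : Uᴴ *ᵥ x = 0 := dotProduct_star_self_eq_zero.1 h4
  have hx : x = 0 := by
    have : (U⁻¹)ᴴ *ᵥ (Uᴴ *ᵥ x) = x := by
      rw [mulVec_mulVec, ← conjTranspose_mul,
        Matrix.mul_nonsing_inv _ ((Matrix.isUnit_iff_isUnit_det _).1 hU), conjTranspose_one,
        one_mulVec]
    rw [← this, h5, mulVec_zero]
  subst hx
  -- The columns of `ψ` are independent: `Z* J` maps `ψ c` to a vector whose lower half is `c`.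
  have hc : c = 0 := by
    have h6 : ψ *ᵥ c = 0 := by
      rw [zero_smul, add_zero] at hp1
      rw [hp1]
      ext i; rcases i with i | i <;> simp
    have h7 : (Zᴴ * J) *ᵥ (ψ *ᵥ c) = Sum.elim (-(M *ᵥ c)) c := by
      rw [mulVec_mulVec, hψ, graphCols, ← Matrix.mul_assoc, hZY, J_mul_fromRows, fromRows_mulVec]
      simp [neg_mulVec]
    rw [h6, mulVec_zero] at h7
    ext i
    exact (congrFun h7 (Sum.inr i)).symm
  exact hp0 (by simp [hc])

variable {S : HamSystem n}

/-- The energy identity for the form `𝒰₂ₙ J`. -/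
theorem energy (U : Matrix (Fin n) (Fin n) ℂ) {F D P w : ℝ → Vec n}
    (hF : ∀ i, DeltaAC S.X S.t₀ (fun t => F t i) (fun t => D t i))
    (hP : ∀ t ∈ S.T, Sum.elim (F t ∘ Sum.inl) (F (sigma S.X t) ∘ Sum.inr) = P t)
    (hw : ∀ t ∈ S.T, Matrix.J (Fin n) ℂ *ᵥ D t = w t) {t : ℝ} (ht : t ∈ S.T) :
    IntegrableOn (fun s => (sesq (U2 U) (P s) (w s)).re) (Ico S.t₀ t) S.dm ∧
    (sesq (U2 U * Matrix.J (Fin n) ℂ) (F t) (F t)).re =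
      (sesq (U2 U * Matrix.J (Fin n) ℂ) (F S.t₀) (F S.t₀)).re +
        2 * ∫ s in Ico S.t₀ t, (sesq (U2 U) (P s) (w s)).re ∂S.dm := by
  have hF' : MatrixAC S.X S.t₀ (fun t => replicateCol Unit (F t))
      (fun t => replicateCol Unit (D t)) := fun i _ => hF i
  have h0 := MatrixAC.conjTranspose_mul_antidiagonal_mul S.isSturmian (-U) (-Uᴴ) hF' hF' () ()
  have hcol : ∀ (K : Mat n) (x y : Vec n),
      ((replicateCol Unit x)ᴴ * K * replicateCol Unit y) () () = sesq K x y := by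
    intro K x y
    rw [Matrix.mul_assoc, Matrix.mul_apply, sesq, dotProduct]
    rfl
  -- Since `𝒰₂ₙ J` is Hermitian, the two terms of the product rule are complex conjugates and add up
  -- to twice a real part.
  have h1 : DeltaAC S.X S.t₀ (fun t => sesq (U2 U * Matrix.J (Fin n) ℂ) (F t) (F t))
      (fun t => ((2 * (sesq (U2 U) (P t) (w t)).re : ℝ) : ℂ)) := by
    refine h0.congr S.isSturmian (fun t _ => ?_) fun t ht => ?_
    · change _ = ((replicateCol Unit (F t))ᴴ * fromBlocks 0 (-U) (-Uᴴ) 0 *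
        replicateCol Unit (F t)) () ()
      rw [hcol, U2_mul_J]
    · have h2 : halfShift S.X (fun t => replicateCol Unit (F t)) t = replicateCol Unit (P t) := by
        rw [← hP t ht]
        ext i j
        rcases i with i | i <;> simp [halfShift]
      change _ = ((replicateCol Unit (D t))ᴴ * fromBlocks 0 (-U) (-Uᴴ) 0 *
        halfShift S.X (fun t => replicateCol Unit (F t)) t +
        (halfShift S.X (fun t => replicateCol Unit (F t)) t)ᴴ * fromBlocks 0 (-U) (-Uᴴ) 0 *
        replicateCol Unit (D t)) () ()
      rw [Matrix.add_apply, h2, hcol, hcol, ← U2_mul_J]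
      have h3 : sesq (U2 U * Matrix.J (Fin n) ℂ) (P t) (D t) = sesq (U2 U) (P t) (w t) := by
        rw [← hw t ht, sesq_mulVec_right]
      have h4 := star_sesq (U2 U * Matrix.J (Fin n) ℂ) (P t) (D t)
      rw [conjTranspose_U2_mul_J] at h4
      rw [← h4, h3, add_comm, Complex.star_def, Complex.add_conj]
  have h2 : IntegrableOn (fun s => (sesq (U2 U) (P s) (w s)).re) (Ico S.t₀ t) S.dm := by
    have := ((h1.integrable t ht).re).const_mul (1 / 2)
    refine this.congr (Eventually.of_forall fun s => ?_)
    simp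
  refine ⟨h2, ?_⟩
  rw [h1.eq t ht, Complex.add_re, integral_complex_ofReal, Complex.ofReal_re, integral_const_mul]
  rfl

/-- Write `λ A + B = (λ₀ A + B) + (λ - λ₀) A`: the first part contributes `W(λ₀)`, the second is
controlled by (1). -/
theorem LambdaBound.le_re_sesq {U : Matrix (Fin n) (Fin n) ℂ} {lam₀ lam : ℂ} {δ : ℝ}
    (hδ : S.LambdaBound U lam₀ lam δ) {t : ℝ} (ht : t ∈ S.T) (y : Vec n) :
    (sesq (S.W U lam₀ t) y y).re + δ * (sesq (S.Atilde U t) y y).re ≤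
      (sesq (U2 U * (lam • S.A t + S.B t)) y y).re := by
  have h1 := (hδ t ht).re_sesq_nonneg y
  rw [sesq_sub_matrix, Complex.sub_re, re_sesq_matRe, sesq_smul_matrix (δ : ℂ), Complex.re_ofReal_mul] at h1
  have h2 : U2 U * (lam • S.A t + S.B t) =
      U2 U * (lam₀ • S.A t + S.B t) + (lam - lam₀) • (U2 U * S.A t) := by
    rw [Matrix.mul_add, Matrix.mul_add, Matrix.mul_smul, Matrix.mul_smul, sub_smul]
    abel
  rw [h2, sesq_add_matrix, Complex.add_re, W, re_sesq_matRe]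
  linarith

theorem sesq_Atilde (U : Matrix (Fin n) (Fin n) ℂ) (t : ℝ) (x y : Vec n) :
    sesq (S.Atilde U t) x y = sesq (S.A t) ((U2 U)ᴴ *ᵥ x) ((U2 U)ᴴ *ᵥ y) := by
  rw [sesq_mulVec_left, sesq_mulVec_right, conjTranspose_conjTranspose, Atilde]

/-- The lower bound for the energy density of the adjoint system. -/
theorem LambdaBound.le_re_sesq_adjoint {U : Matrix (Fin n) (Fin n) ℂ} (hU : IsUnit U)
    {lam₀ lam : ℂ} {δ : ℝ} (hadm : S.Admissible U lam₀) (hδ : S.LambdaBound U lam₀ lam δ)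
    {t : ℝ} (ht : t ∈ S.T) (z : Vec n) :
    δ * (sesq (S.A t) z z).re ≤
      (sesq (U2 U⁻¹) z ((star lam • S.A t + (S.B t)ᴴ) *ᵥ z)).re := by
  -- With `z = 𝒰₂ₙ* x` the adjoint density at `z` becomes the original density at `x`, and the
  -- weight `Ã` at `x` becomes `A` at `z`.
  set x := (U2 U⁻¹)ᴴ *ᵥ z with hx
  have hz : (U2 U)ᴴ *ᵥ x = z := by
    rw [hx, mulVec_mulVec, ← conjTranspose_mul, U2_inv_mul_U2 hU, conjTranspose_one, one_mulVec]
  have h1 := hδ.le_re_sesq ht x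
  have h2 := (hadm t ht).re_sesq_nonneg x
  rw [sesq_Atilde, hz] at h1
  have h3 : (star lam • S.A t + (S.B t)ᴴ) = (lam • S.A t + S.B t)ᴴ := by
    rw [conjTranspose_add, conjTranspose_smul, S.conjTranspose_A ht]
  have h4 : (sesq (U2 U⁻¹) z ((star lam • S.A t + (S.B t)ᴴ) *ᵥ z)).re =
      (sesq (U2 U * (lam • S.A t + S.B t)) x x).re := by
    rw [h3, ← re_sesq_conjTranspose (U2 U * _), conjTranspose_mul, sesq_mulVec_right]
    nth_rw 1 [← hz]
    nth_rw 1 [← hz]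
    rw [sesq_mulVec_left, sesq_mulVec_right, conjTranspose_conjTranspose, ← Matrix.mul_assoc,
      U2_mul_U2_inv hU, Matrix.one_mul]
  rw [h4]; linarith

end HamSystem

/-! ### Variable coefficients, exhaustion of the half-line, Fatou's lemma -/

namespace TimeScale

/-- The shift is placed on `F`, so the term with `D` is the homogeneous equation applied to the
unshifted coefficient vector. -/
theorem MatrixAC.mulVec {X : Set ℝ} {t₀ : ℝ} {m k : Type*} [Fintype k] (h : IsSturmian X t₀)
    {F D : ℝ → Matrix m k ℂ} {c g : ℝ → k → ℂ} (hF : MatrixAC X t₀ F D)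
    (hc : ∀ i, DeltaAC X t₀ (fun t => c t i) (fun t => g t i)) (i : m) :
    DeltaAC X t₀ (fun t => (F t *ᵥ c t) i)
      (fun t => (D t *ᵥ c t + F (sigma X t) *ᵥ g t) i) := by
  have hc' : MatrixAC X t₀ (fun t => replicateCol Unit (c t)) (fun t => replicateCol Unit (g t)) :=
    fun i _ => hc i
  exact MatrixAC.mul' h hF hc' i ()

namespace IsSturmian

variable {X : Set ℝ} {t₀ : ℝ} (h : IsSturmian X t₀)
include h

theorem exists_seq (t₁ : ℝ) : ∃ k : ℕ → ℝ, (∀ j, k j ∈ ray X t₀ ∧ t₁ ≤ k j) ∧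
    Tendsto k atTop atTop := by
  choose k hk1 hk2 using fun j : ℕ => h.exists_gt (max (max t₀ t₁) j)
  refine ⟨k, fun j => ⟨⟨hk1 j, ?_⟩, ?_⟩, ?_⟩
  · exact ((le_max_left t₀ t₁).trans (le_max_left _ _)).trans (hk2 j).le
  · exact ((le_max_right t₀ t₁).trans (le_max_left _ _)).trans (hk2 j).le
  · exact tendsto_atTop_mono (fun j => (le_max_right _ _).trans (hk2 j).le)
      tendsto_natCast_atTop_atTop

theorem aecover_Ico {k : ℕ → ℝ} (hk : Tendsto k atTop atTop) :
    AECover (deltaMeasure X t₀) atTop (fun j => Ico t₀ (k j)) where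
  ae_eventually_mem := by
    filter_upwards [h.ae_mem_ray] with t ht
    filter_upwards [hk.eventually_gt_atTop t] with j hj
    exact ⟨ht.2, hj⟩
  measurableSet _ := measurableSet_Ico

/-- Fatou's lemma along an exhaustion of the half-line. -/
theorem lintegral_le_of_forall_Ico {g : ℕ → ℝ → ℝ≥0∞} {G : ℝ → ℝ≥0∞} {k : ℕ → ℝ} {C : ℝ≥0∞}
    (hk : Tendsto k atTop atTop) (hg : ∀ j, AEMeasurable (g j) (deltaMeasure X t₀))
    (hlim : ∀ t ∈ ray X t₀, Tendsto (fun j => g j t) atTop (𝓝 (G t)))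
    (hC : ∀ j, ∫⁻ t in Ico t₀ (k j), g j t ∂deltaMeasure X t₀ ≤ C) :
    ∫⁻ t, G t ∂deltaMeasure X t₀ ≤ C := by
  have h1 : ∫⁻ t, G t ∂deltaMeasure X t₀ ≤
      ∫⁻ t, liminf (fun j => (Ico t₀ (k j)).indicator (g j) t) atTop ∂deltaMeasure X t₀ := by
    refine lintegral_mono_ae ?_
    filter_upwards [h.ae_mem_ray] with t ht
    refine le_of_eq (Tendsto.liminf_eq ?_).symm
    refine (hlim t ht).congr' ?_
    filter_upwards [hk.eventually_gt_atTop t] with j hj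
    rw [indicator_of_mem (show t ∈ Ico t₀ (k j) from ⟨ht.2, hj⟩)]
  refine h1.trans ((lintegral_liminf_le' fun j => (hg j).indicator measurableSet_Ico).trans ?_)
  simp only [lintegral_indicator measurableSet_Ico]
  refine (liminf_le_liminf (Eventually.of_forall hC)).trans ?_
  rw [liminf_const]

theorem Iio_ae_eq (t : ℝ) : Iio t =ᵐ[deltaMeasure X t₀] Ico t₀ t := by
  filter_upwards [h.ae_mem_ray] with s hs
  exact propext ⟨fun h1 => ⟨hs.2, h1⟩, fun h1 => h1.2⟩

omit h in
theorem aestronglyMeasurable_integral_Ico {g : ℝ → ℂ}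
    (hg : AEStronglyMeasurable g (deltaMeasure X t₀)) :
    AEStronglyMeasurable (fun t => ∫ s in Ico t₀ t, g s ∂deltaMeasure X t₀)
      (deltaMeasure X t₀) := by
  have h1 : AEStronglyMeasurable (fun z : ℝ × ℝ => g z.2)
      ((deltaMeasure X t₀).prod (deltaMeasure X t₀)) := hg.comp_snd
  have hA : MeasurableSet {z : ℝ × ℝ | z.2 ∈ Ico t₀ z.1} :=
    (measurableSet_le measurable_const measurable_snd).inter
      (measurableSet_lt measurable_snd measurable_fst)
  refine (h1.indicator hA).integral_prod_right'.congr (Eventually.of_forall fun t => ?_)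
  simp only
  rw [← integral_indicator measurableSet_Ico]
  rfl

end IsSturmian
end TimeScale

/-! ### Square integrability of the adjoint Weyl solution -/

namespace HamSystem

variable {n : ℕ} {S : HamSystem n} {lam : ℂ} {Yh Zh : ℝ → Mat n}

theorem toCols₁_add_toCols₂_mul (K : Mat n) (M : Matrix (Fin n) (Fin n) ℂ) :
    K.toCols₁ + K.toCols₂ * M = K * graphCols M := by
  conv_rhs => rw [← fromCols_toCols K]
  rw [graphCols, fromCols_mul_fromRows, Matrix.mul_one]

theorem sesq_nonpos_of_mem_weylSet {U M : Matrix (Fin n) (Fin n) ℂ} {t : ℝ}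
    (hM : M ∈ weylSet U Yh t) (c : Fin n → ℂ) :
    (sesq (U2 U * Matrix.J (Fin n) ℂ) ((Yh t * graphCols M) *ᵥ c)
      ((Yh t * graphCols M) *ᵥ c)).re ≤ 0 := by
  have h1 := Matrix.PosSemidef.re_sesq_nonneg hM c
  rw [toCols₁_add_toCols₂_mul, sesq_neg_matrix, Complex.neg_re] at h1
  rw [sesq_mulVec_left, sesq_mulVec_right]
  linarith

theorem aestronglyMeasurable_of_eval {m : Type*} [Fintype m] {y : ℝ → m → ℂ}
    (hy : ∀ i, AEStronglyMeasurable (fun t => y t i) S.dm) : AEStronglyMeasurable y S.dm :=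
  (aemeasurable_pi_lambda _ fun i => (hy i).aemeasurable).aestronglyMeasurable

theorem eval_aestronglyMeasurable {m : Type*} [Fintype m] {y : ℝ → m → ℂ}
    (hy : AEStronglyMeasurable y S.dm) (i : m) : AEStronglyMeasurable (fun t => y t i) S.dm :=
  (continuous_apply i).comp_aestronglyMeasurable hy

theorem aestronglyMeasurable_mulVec {m k : Type*} [Fintype m] [Fintype k] {K : ℝ → Matrix m k ℂ}
    (hK : ContinuousOn K S.T) {y : ℝ → k → ℂ} (hy : AEStronglyMeasurable y S.dm) :
    AEStronglyMeasurable (fun t => K t *ᵥ y t) S.dm := by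
  refine aestronglyMeasurable_of_eval fun i => ?_
  simp only [mulVec, dotProduct]
  refine Finset.aestronglyMeasurable_fun_sum _ fun j _ => ?_
  exact (S.isSturmian.aestronglyMeasurable (continuousOn_pi.1 (continuousOn_pi.1 hK i) j)).mul
    (eval_aestronglyMeasurable hy j)

theorem aestronglyMeasurable_sesq {m k : Type*} [Fintype m] [Fintype k] {K : ℝ → Matrix m k ℂ}
    (hK : ContinuousOn K S.T) {x : ℝ → m → ℂ} {y : ℝ → k → ℂ} (hx : AEStronglyMeasurable x S.dm)
    (hy : AEStronglyMeasurable y S.dm) :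
    AEStronglyMeasurable (fun t => sesq (K t) (x t) (y t)) S.dm := by
  simp only [sesq, dotProduct]
  refine Finset.aestronglyMeasurable_fun_sum _ fun j _ => ?_
  exact (Complex.continuous_conj.comp_aestronglyMeasurable (eval_aestronglyMeasurable hx j)).mul
    (eval_aestronglyMeasurable (aestronglyMeasurable_mulVec hK hy) j)

theorem integrable_re_sesq_A {f : ℝ → Vec n} (hf : S.MemL2 S.A f) :
    Integrable (fun t => (sesq (S.A t) (f t) (f t)).re) S.dm := by
  refine ⟨Complex.continuous_re.comp_aestronglyMeasurable
    (aestronglyMeasurable_sesq S.continuousOn_A hf.1 hf.1), ?_⟩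
  rw [hasFiniteIntegral_iff_ofReal]
  · exact hf.2
  · filter_upwards [S.isSturmian.ae_mem_ray] with t ht
    exact (S.posSemidef_A' ht).re_sesq_nonneg _

theorem integrableOn_sesq_A {z f : ℝ → Vec n} {s : Set ℝ} (hz : AEStronglyMeasurable z S.dm)
    (hzi : IntegrableOn (fun t => (sesq (S.A t) (z t) (z t)).re) s S.dm) (hf : S.MemL2 S.A f) :
    IntegrableOn (fun t => sesq (S.A t) (z t) (f t)) s S.dm := by
  refine (hzi.add (integrable_re_sesq_A hf).integrableOn).mono'
    (aestronglyMeasurable_sesq S.continuousOn_A hz hf.1).restrict ?_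
  filter_upwards [ae_restrict_of_ae S.isSturmian.ae_mem_ray] with t ht
  exact (S.posSemidef_A' ht).norm_sesq_le _ _

theorem aestronglyMeasurable_Z_mulVec (hZ : S.IsAdjointFundamental lam Zh) (u : Vec n) :
    AEStronglyMeasurable (fun t => S.Z lam Zh t *ᵥ u) S.dm :=
  aestronglyMeasurable_mulVec hZ.continuousOn_Z aestronglyMeasurable_const

theorem continuousOn_sesq_Z (hZ : S.IsAdjointFundamental lam Zh) (u : Vec n) :
    ContinuousOn (fun t => sesq (S.A t) (S.Z lam Zh t *ᵥ u) (S.Z lam Zh t *ᵥ u)) S.T := by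
  have h1 := hZ.continuousOn_Z
  have h2 := S.continuousOn_A
  rw [continuousOn_iff_continuous_domRestrict] at *
  have h3 := h1.matrix_mulVec (continuous_const (y := u))
  exact h3.star.dotProduct (h2.matrix_mulVec h3)

theorem integrableOn_sesq_Z (hZ : S.IsAdjointFundamental lam Zh) (u : Vec n) {t : ℝ}
    (ht : t ∈ S.T) :
    IntegrableOn (fun t => (sesq (S.A t) (S.Z lam Zh t *ᵥ u) (S.Z lam Zh t *ᵥ u)).re)
      (Ico S.t₀ t) S.dm :=
  (S.isSturmian.integrableOn_Ico (continuousOn_sesq_Z hZ u) ht).re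

theorem sumElim_mulVec_eq_halfShift_mulVec {X : Set ℝ} (K : ℝ → Mat n) (t : ℝ) (u : Vec n) :
    Sum.elim ((K t *ᵥ u) ∘ Sum.inl) ((K (sigma X t) *ᵥ u) ∘ Sum.inr) = halfShift X K t *ᵥ u := by
  ext i
  rcases i with i | i <;> rfl

/-- The adjoint Weyl solution is square integrable with respect to `A`. -/
theorem integrable_sesq_zeta {U : Matrix (Fin n) (Fin n) ℂ} (hU : IsUnit U) {lam₀ : ℂ} {δ : ℝ}
    (hadm : S.Admissible U lam₀) (hδ0 : 0 < δ) (hδ : S.LambdaBound U lam₀ lam δ)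
    (hY : S.IsFundamental lam Yh) (hZ : S.IsAdjointFundamental lam Zh)
    {M : Matrix (Fin n) (Fin n) ℂ} (hM : M ∈ S.weylLimitSet U Yh) (v : Fin n → ℂ) :
    Integrable (fun t => (sesq (S.A t) (S.Z lam Zh t *ᵥ (graphCols Mᴴ *ᵥ v))
      (S.Z lam Zh t *ᵥ (graphCols Mᴴ *ᵥ v))).re) S.dm := by
  obtain ⟨t₁, ht₁, hM⟩ := hM
  set u := graphCols Mᴴ *ᵥ v with hu
  set e : ℝ → ℝ := fun t => (sesq (U2 U⁻¹ * Matrix.J (Fin n) ℂ) (Zh t *ᵥ u) (Zh t *ᵥ u)).re with he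
  have hen : ∀ t ∈ S.T, _ ∧ _ := fun t ht => S.energy U⁻¹ (F := fun t => Zh t *ᵥ u)
    (P := fun t => S.Z lam Zh t *ᵥ u)
    (w := fun t => (star lam • S.A t + (S.B t)ᴴ) *ᵥ (S.Z lam Zh t *ᵥ u))
    (MatrixAC.mulVec S.isSturmian hZ.matrixAC (c := fun _ => u) (g := fun _ => 0)
      fun i => DeltaAC.const _)
    (fun t ht => by rw [sumElim_mulVec_eq_halfShift_mulVec, hZ.halfShift_eq ht])
    (fun t ht => by
      simp only [mulVec_zero, add_zero]
      rw [mulVec_mulVec, J_mul_neg_J_mul, ← mulVec_mulVec]) ht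
  obtain ⟨k, hk, hkt⟩ := S.isSturmian.exists_seq t₁
  have hq0 : ∀ t ∈ S.T, 0 ≤ (sesq (S.A t) (S.Z lam Zh t *ᵥ u) (S.Z lam Zh t *ᵥ u)).re :=
    fun t ht => (S.posSemidef_A' ht).re_sesq_nonneg _
  have hm : AEStronglyMeasurable
      (fun t => (sesq (S.A t) (S.Z lam Zh t *ᵥ u) (S.Z lam Zh t *ᵥ u)).re) S.dm :=
    Complex.continuous_re.comp_aestronglyMeasurable
      (S.isSturmian.aestronglyMeasurable (continuousOn_sesq_Z hZ u))
  have hae : ∀ᵐ t ∂S.dm, 0 ≤ (sesq (S.A t) (S.Z lam Zh t *ᵥ u) (S.Z lam Zh t *ᵥ u)).re :=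
    S.isSturmian.ae_mem_ray.mono hq0
  refine ⟨hm, ?_⟩
  rw [hasFiniteIntegral_iff_ofReal hae]
  -- The energy is at most zero at `k j`, and its derivative is at least `2 δ` times the integrand;
  -- so the integral up to `k j` is at most `-e(t₀) / (2 δ)`, uniformly in `j`.
  refine lt_of_le_of_lt (S.isSturmian.lintegral_le_of_forall_Ico
    (C := ENNReal.ofReal (-e S.t₀ / (2 * δ))) hkt (g := fun _ => _)
    (fun j => hm.aemeasurable.ennreal_ofReal) (fun t _ => tendsto_const_nhds) fun j => ?_)
    ENNReal.ofReal_lt_top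
  obtain ⟨hkT, hkj⟩ := hk j
  obtain ⟨hi, heq⟩ := hen (k j) hkT
  have hqi := integrableOn_sesq_Z hZ u hkT
  refine (ofReal_integral_eq_lintegral_ofReal hqi (ae_restrict_of_ae hae)).symm.trans_le ?_
  refine ENNReal.ofReal_le_ofReal ?_
  have h1 : e (k j) ≤ 0 := by
    have := re_sesq_dual_nonpos hU (hY.wronskian hZ hkT)
      (sesq_nonpos_of_mem_weylSet (hM (k j) hkT hkj)) v
    rwa [← mulVec_mulVec] at this
  have h2 : δ * ∫ t in Ico S.t₀ (k j),
      (sesq (S.A t) (S.Z lam Zh t *ᵥ u) (S.Z lam Zh t *ᵥ u)).re ∂S.dm ≤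
      ∫ t in Ico S.t₀ (k j), (sesq (U2 U⁻¹) (S.Z lam Zh t *ᵥ u)
        ((star lam • S.A t + (S.B t)ᴴ) *ᵥ (S.Z lam Zh t *ᵥ u))).re ∂S.dm := by
    rw [← integral_const_mul]
    refine integral_mono_ae (hqi.const_mul δ) hi (ae_restrict_of_ae ?_)
    filter_upwards [S.isSturmian.ae_mem_ray] with t ht
    exact hδ.le_re_sesq_adjoint hU hadm ht _
  rw [le_div_iff₀ (by positivity)]
  change e (k j) = e S.t₀ + _ at heq
  linarith

end HamSystem

/-! ### Variation of constants and the estimate on bounded intervals -/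

namespace HamSystem

variable {n : ℕ} {S : HamSystem n} {lam : ℂ} {Yh Zh : ℝ → Mat n}

/-- The source term `Z* A f = (η* A f, χ* A f)`. -/
def source (S : HamSystem n) (lam : ℂ) (Zh : ℝ → Mat n) (f : ℝ → Vec n) (t : ℝ) : Vec n :=
  (S.Z lam Zh t)ᴴ *ᵥ (S.A t *ᵥ f t)

/-- The term `ζ* A f`. -/
def weylSource (S : HamSystem n) (lam : ℂ) (Zh : ℝ → Mat n) (M : Matrix (Fin n) (Fin n) ℂ)
    (f : ℝ → Vec n) (t : ℝ) : Fin n → ℂ :=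
  source S lam Zh f t ∘ Sum.inl + M *ᵥ (source S lam Zh f t ∘ Sum.inr)

/-- The derivative `(χ* A f, -η* A f)` of the coefficient vector. -/
def coeffDeriv (S : HamSystem n) (lam : ℂ) (Zh : ℝ → Mat n) (f : ℝ → Vec n) (t : ℝ) : Vec n :=
  -(Matrix.J (Fin n) ℂ *ᵥ source S lam Zh f t)

/-- The coefficient vector with initial value `(0, b)`. -/
def coeff (S : HamSystem n) (lam : ℂ) (Zh : ℝ → Mat n) (f : ℝ → Vec n) (b : Fin n → ℂ) (t : ℝ) :
    Vec n :=
  fun i => Sum.elim (0 : Fin n → ℂ) b i + ∫ s in Ico S.t₀ t, coeffDeriv S lam Zh f s i ∂S.dm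

/-- The solution `Y c + N A f` of the inhomogeneous system. -/
def particular (S : HamSystem n) (lam : ℂ) (Yh Zh : ℝ → Mat n) (f : ℝ → Vec n) (b : Fin n → ℂ)
    (t : ℝ) : Vec n :=
  S.Y lam Yh t *ᵥ coeff S lam Zh f b t + S.N t *ᵥ (S.A t *ᵥ f t)

theorem coeffDeriv_inl (f : ℝ → Vec n) (t : ℝ) (i : Fin n) :
    coeffDeriv S lam Zh f t (Sum.inl i) = source S lam Zh f t (Sum.inr i) := by
  rw [coeffDeriv, Matrix.J, fromBlocks_mulVec]
  simp [neg_mulVec]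

theorem coeffDeriv_inr (f : ℝ → Vec n) (t : ℝ) (i : Fin n) :
    coeffDeriv S lam Zh f t (Sum.inr i) = -source S lam Zh f t (Sum.inl i) := by
  rw [coeffDeriv, Matrix.J, fromBlocks_mulVec]
  simp

/-- Each component is an `A`-pairing of a solution with `f`, so `integrableOn_sesq_A` applies. -/
theorem source_eq_sesq (f : ℝ → Vec n) (t : ℝ) (i : Fin n ⊕ Fin n) :
    source S lam Zh f t i = sesq (S.A t) (S.Z lam Zh t *ᵥ Pi.single i 1) (f t) := by
  rw [sesq_mulVec_left, sesq, ← mulVec_mulVec, source, ← Pi.single_star, star_one,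
    single_one_dotProduct]

theorem weylSource_eq_sesq (M : Matrix (Fin n) (Fin n) ℂ) (f : ℝ → Vec n) (t : ℝ) (i : Fin n) :
    weylSource S lam Zh M f t i =
      sesq (S.A t) (S.Z lam Zh t *ᵥ (graphCols Mᴴ *ᵥ Pi.single i 1)) (f t) := by
  rw [sesq_mulVec_left, sesq_mulVec_left, sesq, ← Pi.single_star, star_one, single_one_dotProduct,
    ← mulVec_mulVec, ← mulVec_mulVec, graphCols, conjTranspose_fromRows_eq_fromCols_conjTranspose,
    conjTranspose_one, conjTranspose_conjTranspose, fromCols_mulVec, Matrix.one_mulVec]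
  rfl

theorem integrableOn_source (hZ : S.IsAdjointFundamental lam Zh) {f : ℝ → Vec n}
    (hf : S.MemL2 S.A f) {t : ℝ} (ht : t ∈ S.T) (i : Fin n ⊕ Fin n) :
    IntegrableOn (fun s => source S lam Zh f s i) (Ico S.t₀ t) S.dm := by
  simp only [source_eq_sesq]
  exact integrableOn_sesq_A (aestronglyMeasurable_Z_mulVec hZ _) (integrableOn_sesq_Z hZ _ ht) hf

theorem aestronglyMeasurable_source (hZ : S.IsAdjointFundamental lam Zh) {f : ℝ → Vec n}
    (hf : S.MemL2 S.A f) (i : Fin n ⊕ Fin n) :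
    AEStronglyMeasurable (fun s => source S lam Zh f s i) S.dm := by
  simp only [source_eq_sesq]
  exact aestronglyMeasurable_sesq S.continuousOn_A (aestronglyMeasurable_Z_mulVec hZ _) hf.1

theorem integrableOn_coeffDeriv (hZ : S.IsAdjointFundamental lam Zh) {f : ℝ → Vec n}
    (hf : S.MemL2 S.A f) {t : ℝ} (ht : t ∈ S.T) (i : Fin n ⊕ Fin n) :
    IntegrableOn (fun s => coeffDeriv S lam Zh f s i) (Ico S.t₀ t) S.dm := by
  rcases i with i | i
  · simp only [coeffDeriv_inl]; exact integrableOn_source hZ hf ht _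
  · simp only [coeffDeriv_inr]; exact (integrableOn_source hZ hf ht _).neg

theorem aestronglyMeasurable_coeffDeriv (hZ : S.IsAdjointFundamental lam Zh) {f : ℝ → Vec n}
    (hf : S.MemL2 S.A f) (i : Fin n ⊕ Fin n) :
    AEStronglyMeasurable (fun s => coeffDeriv S lam Zh f s i) S.dm := by
  rcases i with i | i
  · simp only [coeffDeriv_inl]; exact aestronglyMeasurable_source hZ hf _
  · simp only [coeffDeriv_inr]; exact (aestronglyMeasurable_source hZ hf _).neg

theorem coeff_t₀ (f : ℝ → Vec n) (b : Fin n → ℂ) :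
    coeff S lam Zh f b S.t₀ = Sum.elim (0 : Fin n → ℂ) b := by
  ext i
  simp [coeff]

theorem deltaAC_coeff (hZ : S.IsAdjointFundamental lam Zh) {f : ℝ → Vec n}
    (hf : S.MemL2 S.A f) (b : Fin n → ℂ) (i : Fin n ⊕ Fin n) :
    DeltaAC S.X S.t₀ (fun t => coeff S lam Zh f b t i) (fun t => coeffDeriv S lam Zh f t i) where
  integrable _ ht := integrableOn_coeffDeriv hZ hf ht i
  eq t _ := by
    rw [coeff_t₀, coeff]
    rfl

/-- It rests on `E₂ = 1 - μ B₂ E₂`. Variation of constants produces `H̃* A f` as forcing instead of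
`A f`; by this identity the surplus is `(λ A + B) N A f`, which is accounted for by adding `N A f`
to the solution. -/
theorem conjTranspose_Htilde (lam : ℂ) {t : ℝ} (ht : t ∈ S.T) :
    (S.Htilde lam t)ᴴ = 1 + (lam • S.A t + S.B t) * S.N t := by
  have hA : (S.A₂ t)ᴴ = S.A₂ t := by
    have := S.conjTranspose_A ht
    rw [A, fromBlocks_conjTranspose, fromBlocks_inj] at this
    exact this.2.2.2
  have hmu : star (S.μc t) = S.μc t := Complex.conj_ofReal _
  have h1 := S.one_add_mul_E₂ ht
  have h2 : S.E₂ t = 1 + -(S.μc t • (S.B₂ t * S.E₂ t)) := by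
    rw [Matrix.add_mul, Matrix.one_mul, Matrix.smul_mul] at h1
    rw [← h1]; abel
  rw [Htilde, fromBlocks_conjTranspose, A, B, N, fromBlocks_smul, fromBlocks_add,
    fromBlocks_multiply, ← fromBlocks_one, fromBlocks_add]
  simp only [conjTranspose_neg, conjTranspose_smul, conjTranspose_mul, conjTranspose_add,
    conjTranspose_conjTranspose, star_star, hmu, hA, conjTranspose_zero, conjTranspose_one,
    Matrix.mul_zero, add_zero, zero_add, smul_zero, Matrix.mul_neg, Matrix.mul_smul]
  rw [← h2]

theorem J_mulVec_sigma (hY : S.IsFundamental lam Yh) (hZ : S.IsAdjointFundamental lam Zh)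
    (f : ℝ → Vec n) {t : ℝ} (ht : t ∈ S.T) :
    Matrix.J (Fin n) ℂ *ᵥ (Yh (sigma S.X t) *ᵥ coeffDeriv S lam Zh f t) =
      (lam • S.A t + S.B t) *ᵥ (S.N t *ᵥ (S.A t *ᵥ f t)) + S.A t *ᵥ f t := by
  have h1 := hY.wronskian' hZ (S.isSturmian.sigma_mem_ray ht)
  have h2 : -(Matrix.J (Fin n) ℂ * Yh (sigma S.X t) * Matrix.J (Fin n) ℂ * (S.Z lam Zh t)ᴴ) =
      1 + (lam • S.A t + S.B t) * S.N t := by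
    rw [Matrix.mul_assoc, Matrix.mul_assoc, Z, conjTranspose_mul, ← Matrix.mul_assoc (Matrix.J _ _) (Zh _)ᴴ, ← Matrix.mul_assoc (Yh _),
      ← Matrix.mul_assoc (Yh _), h1, neg_J_mul_J_mul, conjTranspose_Htilde lam ht]
  rw [coeffDeriv, source, mulVec_neg, mulVec_neg, mulVec_mulVec, mulVec_mulVec, mulVec_mulVec,
    ← neg_mulVec, h2, Matrix.add_mulVec, Matrix.one_mulVec, add_comm, mulVec_mulVec _ _ (S.N t)]

theorem sumElim_eq_of_J_mulVec_eq (lam : ℂ) {t : ℝ} (ht : t ∈ S.T) {p d q : Vec n}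
    (hd : Matrix.J (Fin n) ℂ *ᵥ d =
      (lam • S.A t + S.B t) *ᵥ (S.H lam t *ᵥ p + S.N t *ᵥ q) + q) :
    Sum.elim (p ∘ Sum.inl) ((p + S.μc t • d) ∘ Sum.inr) = S.H lam t *ᵥ p + S.N t *ᵥ q := by
  have h1 := S.halfShift_eq_of_J_mul_eq lam ht (p := replicateCol Unit p)
    (d := replicateCol Unit d) (q := replicateCol Unit q) (by
      ext i j
      exact congrFun hd i)
  ext i
  have h2 := congrFun (congrFun h1 i) ()
  rcases i with i | i <;> exact h2

/-- The energy estimate on a bounded interval. -/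
theorem lintegral_particular_le {U : Matrix (Fin n) (Fin n) ℂ} {lam₀ : ℂ} {δ : ℝ}
    (hadm : S.Admissible U lam₀) (hδ : S.LambdaBound U lam₀ lam δ)
    (hY : S.IsFundamental lam Yh) (hZ : S.IsAdjointFundamental lam Zh)
    {M : Matrix (Fin n) (Fin n) ℂ} {f : ℝ → Vec n} (hf : S.MemL2 S.A f) {k : ℝ} (hk : k ∈ S.T)
    (hM : M ∈ weylSet U Yh k) {ε : ℝ} (hε : 0 < ε) (hεδ : ε < δ) {Φ : ℝ → Vec n}
    (hΦ : Φ = particular S lam Yh Zh f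
      (fun i => ∫ s in Ico S.t₀ k, weylSource S lam Zh M f s i ∂S.dm)) :
    ∫⁻ t in Ico S.t₀ k, (ENNReal.ofReal (sesq (S.W U lam₀ t) (Φ t) (Φ t)).re +
      ENNReal.ofReal (δ - ε) * ENNReal.ofReal (sesq (S.Atilde U t) (Φ t) (Φ t)).re) ∂S.dm ≤
      ENNReal.ofReal (1 / (4 * ε)) * S.normSq S.A f := by
  set b : Fin n → ℂ := fun i => ∫ s in Ico S.t₀ k, weylSource S lam Zh M f s i ∂S.dm with hb
  set c := coeff S lam Zh f b with hc
  set w : ℝ → Vec n := fun t => (lam • S.A t + S.B t) *ᵥ Φ t + S.A t *ᵥ f t with hw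
  -- `Ŷ c` solves the inhomogeneous system with source `A f`; `hP` identifies its half-shift with
  -- `Φ`.
  have hJ : ∀ t ∈ S.T, Matrix.J (Fin n) ℂ *ᵥ
      (-(Matrix.J (Fin n) ℂ * ((lam • S.A t + S.B t) * S.Y lam Yh t)) *ᵥ c t +
        Yh (sigma S.X t) *ᵥ coeffDeriv S lam Zh f t) = w t := by
    intro t ht
    rw [mulVec_add, J_mulVec_sigma hY hZ f ht, mulVec_mulVec, J_mul_neg_J_mul, hw]
    simp only [hΦ, particular, mulVec_add, ← hc]
    rw [mulVec_mulVec _ _ (S.Y lam Yh t), add_assoc]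
  have hAC := MatrixAC.mulVec S.isSturmian hY.matrixAC (deltaAC_coeff hZ hf b)
  have hP : ∀ t ∈ S.T, Sum.elim ((Yh t *ᵥ c t) ∘ Sum.inl)
      ((Yh (sigma S.X t) *ᵥ c (sigma S.X t)) ∘ Sum.inr) = Φ t := by
    intro t ht
    have h1 : Yh (sigma S.X t) *ᵥ c (sigma S.X t) = Yh t *ᵥ c t + S.μc t •
        (-(Matrix.J (Fin n) ℂ * ((lam • S.A t + S.B t) * S.Y lam Yh t)) *ᵥ c t +
        Yh (sigma S.X t) *ᵥ coeffDeriv S lam Zh f t) := by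
      ext i
      exact (hAC i).map_sigma S.isSturmian ht
    have h2 : Φ t = S.H lam t *ᵥ (Yh t *ᵥ c t) + S.N t *ᵥ (S.A t *ᵥ f t) := by
      rw [hΦ, particular, mulVec_mulVec _ (S.H lam t) (Yh t)]
      rfl
    rw [h1, h2]
    refine sumElim_eq_of_J_mulVec_eq lam ht ?_
    rw [hJ t ht, ← h2]
  obtain ⟨hi, heq⟩ := S.energy U hAC hP hJ hk
  -- The initial value `J (0, b) = (-b, 0)` is isotropic for the off-diagonal form.
  have hcol : ∀ b : Fin n → ℂ, sesq (U2 U * Matrix.J (Fin n) ℂ)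
      (Matrix.J (Fin n) ℂ *ᵥ Sum.elim 0 b) (Matrix.J (Fin n) ℂ *ᵥ Sum.elim 0 b) = 0 := by
    intro b
    have h1 : Matrix.J (Fin n) ℂ *ᵥ Sum.elim 0 b = Sum.elim (-b) 0 := by
      rw [Matrix.J, fromBlocks_mulVec]
      simp [neg_mulVec]
    have h2 : star (Sum.elim (-b) (0 : Fin n → ℂ)) = Sum.elim (star (-b)) 0 := by
      ext i; rcases i with i | i <;> simp
    rw [h1, U2_mul_J, sesq, fromBlocks_mulVec, h2, sumElim_dotProduct_sumElim]
    simp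
  -- As `b` is truncated at `k`, the lower half of `c(k)` is `b - ∫ η* A f = M ∫ χ* A f`. So the
  -- solution at `k` lies in the subspace governed by `D(k, λ)`.
  have hend : c k = graphCols M *ᵥ
      fun i => ∫ s in Ico S.t₀ k, source S lam Zh f s (Sum.inr i) ∂S.dm := by
    ext i
    rw [graphCols, fromRows_mulVec]
    rcases i with i | i
    · simp [hc, coeff, coeffDeriv_inl]
    · simp only [hc, coeff, hb, coeffDeriv_inr, Sum.elim_inr, weylSource, Pi.add_apply,
        Function.comp_apply, integral_neg, mulVec, dotProduct]
      rw [integral_add (integrableOn_source hZ hf hk _)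
        (integrable_finsetSum _ fun j _ => (integrableOn_source hZ hf hk _).const_mul _),
        integral_finsetSum _ fun j _ => (integrableOn_source hZ hf hk _).const_mul _]
      simp only [integral_const_mul]
      ring
  have hneg : (sesq (U2 U * Matrix.J (Fin n) ℂ) (Yh k *ᵥ c k) (Yh k *ᵥ c k)).re ≤ 0 := by
    rw [hend, mulVec_mulVec]
    exact sesq_nonpos_of_mem_weylSet hM _
  change (sesq (U2 U * Matrix.J (Fin n) ℂ) (Yh k *ᵥ c k) (Yh k *ᵥ c k)).re =
    (sesq (U2 U * Matrix.J (Fin n) ℂ) (Yh S.t₀ *ᵥ c S.t₀) (Yh S.t₀ *ᵥ c S.t₀)).re + _ at heq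
  rw [hY.1, hc, coeff_t₀, hcol, Complex.zero_re, zero_add] at heq
  -- Young's inequality is applied to `𝒰₂ₙ* Φ` and `f` in the weight `A`, which costs `ε` times the
  -- `Ã`-form of `Φ`.
  have hpt : ∀ t ∈ S.T, (sesq (S.W U lam₀ t) (Φ t) (Φ t)).re +
      (δ - ε) * (sesq (S.Atilde U t) (Φ t) (Φ t)).re ≤
      (sesq (U2 U) (Φ t) (w t)).re + 1 / (4 * ε) * (sesq (S.A t) (f t) (f t)).re := by
    intro t ht
    have h1 := hδ.le_re_sesq ht (Φ t)
    have h2 := (S.posSemidef_A' ht).neg_re_sesq_le hε ((U2 U)ᴴ *ᵥ Φ t) (f t)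
    rw [← sesq_Atilde, sesq_mulVec_left, conjTranspose_conjTranspose] at h2
    simp only [hw]
    rw [sesq_add_right, sesq_mulVec_right, sesq_mulVec_right, Complex.add_re]
    linarith
  have hW : ∀ t ∈ S.T, 0 ≤ (sesq (S.W U lam₀ t) (Φ t) (Φ t)).re :=
    fun t ht => (hadm t ht).re_sesq_nonneg _
  have hA : ∀ t ∈ S.T, 0 ≤ (sesq (S.Atilde U t) (Φ t) (Φ t)).re := fun t ht => by
    rw [sesq_Atilde]; exact (S.posSemidef_A' ht).re_sesq_nonneg _
  have hT : ∀ᵐ t ∂S.dm.restrict (Ico S.t₀ k), t ∈ S.T := ae_restrict_of_ae S.isSturmian.ae_mem_ray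
  have hfi := integrable_re_sesq_A hf
  have hsum : IntegrableOn (fun t => (sesq (U2 U) (Φ t) (w t)).re +
      1 / (4 * ε) * (sesq (S.A t) (f t) (f t)).re) (Ico S.t₀ k) S.dm :=
    hi.add (hfi.integrableOn.const_mul _)
  calc _ ≤ ∫⁻ t in Ico S.t₀ k, ENNReal.ofReal ((sesq (U2 U) (Φ t) (w t)).re +
        1 / (4 * ε) * (sesq (S.A t) (f t) (f t)).re) ∂S.dm := by
        refine lintegral_mono_ae ?_
        filter_upwards [hT] with t ht
        rw [← ENNReal.ofReal_mul (by linarith), ← ENNReal.ofReal_add (hW t ht)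
          (mul_nonneg (by linarith) (hA t ht))]
        exact ENNReal.ofReal_le_ofReal (hpt t ht)
    _ = ENNReal.ofReal (∫ t in Ico S.t₀ k, ((sesq (U2 U) (Φ t) (w t)).re +
        1 / (4 * ε) * (sesq (S.A t) (f t) (f t)).re) ∂S.dm) := by
        refine (ofReal_integral_eq_lintegral_ofReal hsum ?_).symm
        filter_upwards [hT] with t ht
        exact (add_nonneg (hW t ht) (mul_nonneg (by linarith) (hA t ht))).trans (hpt t ht)
    _ ≤ ENNReal.ofReal (1 / (4 * ε) *
        ∫ t in Ico S.t₀ k, (sesq (S.A t) (f t) (f t)).re ∂S.dm) := by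
        refine ENNReal.ofReal_le_ofReal ?_
        rw [integral_add hi (hfi.integrableOn.const_mul _), integral_const_mul]
        -- By `heq` and `hneg` the energy density integrates to at most zero, so only the forcing
        -- term survives.
        linarith
    _ ≤ _ := by
        rw [ENNReal.ofReal_mul (by positivity)]
        gcongr
        rw [ofReal_integral_eq_lintegral_ofReal hfi.integrableOn]
        · exact setLIntegral_le_lintegral _ _
        · filter_upwards [hT] with t ht
          exact (S.posSemidef_A' ht).re_sesq_nonneg _

end HamSystem

/-! ### The resolvent as a limit of truncated solutions -/

namespace HamSystem

variable {n : ℕ} {S : HamSystem n} {lam : ℂ} {Yh Zh : ℝ → Mat n}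

theorem toCols₂_mulVec (K : Mat n) (v : Fin n → ℂ) :
    K.toCols₂ *ᵥ v = K *ᵥ Sum.elim (0 : Fin n → ℂ) v := by
  conv_rhs => rw [← fromCols_toCols K, fromCols_mulVec_sumElim]
  rw [mulVec_zero, zero_add]

theorem conjTranspose_zeta_mulVec (M : Matrix (Fin n) (Fin n) ℂ) (f : ℝ → Vec n) (s : ℝ) :
    (S.zeta lam Zh M s)ᴴ *ᵥ (S.A s *ᵥ f s) = weylSource S lam Zh M f s := by
  rw [zeta, chi, toCols₁_add_toCols₂_mul, conjTranspose_mul, ← mulVec_mulVec, graphCols,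
    conjTranspose_fromRows_eq_fromCols_conjTranspose, conjTranspose_one,
    conjTranspose_conjTranspose, fromCols_mulVec, Matrix.one_mulVec]
  rfl

/-- The terms with `M` agree in `ψ χ*` and `φ ζ*`, so the two differ by `θ χ* - φ η*`, which is `Y`
applied to the coefficient derivative. Hence `R_λ f` is a variation of constants formula with
initial coefficients `(0, ∫ ζ* A f)`. -/
theorem green_mulVec (M : Matrix (Fin n) (Fin n) ℂ) (f : ℝ → Vec n) (t s : ℝ) :
    S.green lam Yh Zh M t s *ᵥ (S.A s *ᵥ f s) = S.Y lam Yh t *ᵥ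
      fun i => Sum.elim (0 : Fin n → ℂ) (weylSource S lam Zh M f s) i +
        (Iio t).indicator (fun s => coeffDeriv S lam Zh f s i) s := by
  rw [green]
  split_ifs with h
  · have h1 : (S.chi lam Zh s)ᴴ *ᵥ (S.A s *ᵥ f s) = source S lam Zh f s ∘ Sum.inr := rfl
    rw [psi, phi, toCols₁_add_toCols₂_mul, Matrix.mul_assoc, ← mulVec_mulVec, ← mulVec_mulVec, h1]
    congr 1
    ext i
    rw [indicator_of_mem (mem_Iio.2 h), graphCols, fromRows_mulVec]
    rcases i with i | i
    · simp [coeffDeriv_inl]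
    · simp [coeffDeriv_inr, weylSource]
  · rw [← mulVec_mulVec, conjTranspose_zeta_mulVec, phi, toCols₂_mulVec]
    congr 1
    ext i
    rw [indicator_of_notMem (by simpa using h), add_zero]

theorem integrable_weylSource {U : Matrix (Fin n) (Fin n) ℂ} (hU : IsUnit U) {lam₀ : ℂ} {δ : ℝ}
    (hadm : S.Admissible U lam₀) (hδ0 : 0 < δ) (hδ : S.LambdaBound U lam₀ lam δ)
    (hY : S.IsFundamental lam Yh) (hZ : S.IsAdjointFundamental lam Zh)
    {M : Matrix (Fin n) (Fin n) ℂ} (hM : M ∈ S.weylLimitSet U Yh) {f : ℝ → Vec n}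
    (hf : S.MemL2 S.A f) (i : Fin n) :
    Integrable (fun s => weylSource S lam Zh M f s i) S.dm := by
  simp only [weylSource_eq_sesq]
  rw [← integrableOn_univ]
  exact integrableOn_sesq_A (aestronglyMeasurable_Z_mulVec hZ _)
    (integrable_sesq_zeta hU hadm hδ0 hδ hY hZ hM _).integrableOn hf

theorem aestronglyMeasurable_coeff (hZ : S.IsAdjointFundamental lam Zh) {f : ℝ → Vec n}
    (hf : S.MemL2 S.A f) (b : Fin n → ℂ) :
    AEStronglyMeasurable (coeff S lam Zh f b) S.dm :=
  aestronglyMeasurable_of_eval fun i => aestronglyMeasurable_const.add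
    (IsSturmian.aestronglyMeasurable_integral_Ico (aestronglyMeasurable_coeffDeriv hZ hf i))

theorem aestronglyMeasurable_particular (hY : S.IsFundamental lam Yh)
    (hZ : S.IsAdjointFundamental lam Zh) {f : ℝ → Vec n} (hf : S.MemL2 S.A f) (b : Fin n → ℂ) :
    AEStronglyMeasurable (particular S lam Yh Zh f b) S.dm :=
  (aestronglyMeasurable_mulVec hY.continuousOn_Y (aestronglyMeasurable_coeff hZ hf b)).add
    (aestronglyMeasurable_mulVec S.continuousOn_N (aestronglyMeasurable_mulVec S.continuousOn_A hf.1))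

/-- Truncation affects only `b`, so this gives pointwise convergence of the truncated solutions. -/
theorem continuous_particular (f : ℝ → Vec n) (t : ℝ) :
    Continuous fun b => particular S lam Yh Zh f b t := by
  have h1 : Continuous fun b => coeff S lam Zh f b t := by
    refine continuous_pi fun i => ?_
    rcases i with i | i
    · exact continuous_const (y := coeff S lam Zh f 0 t (Sum.inl i))
    · exact Continuous.add (continuous_apply (A := fun _ => ℂ) i) continuous_const
  have h2 : Continuous fun b => S.Y lam Yh t *ᵥ coeff S lam Zh f b t :=
    continuous_const.matrix_mulVec h1
  exact h2.add continuous_const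

section Resolvent

variable {M : Matrix (Fin n) (Fin n) ℂ} {f : ℝ → Vec n}

theorem integrable_green (hZ : S.IsAdjointFundamental lam Zh) (hf : S.MemL2 S.A f)
    (hw : ∀ i, Integrable (fun s => weylSource S lam Zh M f s i) S.dm) {t : ℝ} (ht : t ∈ S.T) :
    (∀ i, Integrable (fun s => Sum.elim (0 : Fin n → ℂ) (weylSource S lam Zh M f s) i +
      (Iio t).indicator (fun s => coeffDeriv S lam Zh f s i) s) S.dm) ∧
    Integrable (fun s => S.green lam Yh Zh M t s *ᵥ (S.A s *ᵥ f s)) S.dm := by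
  have h1 : ∀ i, Integrable (fun s => Sum.elim (0 : Fin n → ℂ) (weylSource S lam Zh M f s) i +
      (Iio t).indicator (fun s => coeffDeriv S lam Zh f s i) s) S.dm := by
    intro i
    refine Integrable.add ?_ ?_
    · rcases i with i | i
      · exact integrable_zero _ _ _
      · exact hw i
    · rw [integrable_indicator_iff measurableSet_Iio]
      exact (integrableOn_coeffDeriv hZ hf ht i).congr_set_ae (S.isSturmian.Iio_ae_eq t)
  refine ⟨h1, ?_⟩
  simp only [green_mulVec]
  refine Integrable.of_eval fun i => ?_
  simp only [mulVec, dotProduct]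
  exact integrable_finsetSum _ fun j _ => (h1 j).const_mul _

theorem R_eq_particular (hZ : S.IsAdjointFundamental lam Zh) (hf : S.MemL2 S.A f)
    (hw : ∀ i, Integrable (fun s => weylSource S lam Zh M f s i) S.dm) {t : ℝ} (ht : t ∈ S.T) :
    S.R lam Yh Zh M f t =
      particular S lam Yh Zh f (fun i => ∫ s, weylSource S lam Zh M f s i ∂S.dm) t := by
  obtain ⟨h1, h2⟩ := integrable_green (Yh := Yh) hZ hf hw ht
  rw [R, particular]
  congr 1
  ext i
  rw [eval_integral fun i => h2.eval i]
  simp only [green_mulVec]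
  simp only [mulVec, dotProduct]
  rw [integral_finsetSum _ fun j _ => (h1 j).const_mul _]
  refine Finset.sum_congr rfl fun j _ => ?_
  rw [integral_const_mul]
  congr 1
  have h3 : IntegrableOn (fun s => coeffDeriv S lam Zh f s j) (Iio t) S.dm :=
    (integrableOn_coeffDeriv hZ hf ht j).congr_set_ae (S.isSturmian.Iio_ae_eq t)
  have h4 : ∫ s in Ico S.t₀ t, coeffDeriv S lam Zh f s j ∂S.dm =
      ∫ s in Iio t, coeffDeriv S lam Zh f s j ∂S.dm :=
    (setIntegral_congr_set (S.isSturmian.Iio_ae_eq t)).symm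
  rw [coeff, h4]
  rcases j with j | j
  · simp only [Sum.elim_inl, Pi.zero_apply, zero_add]
    rw [integral_indicator measurableSet_Iio]
  · simp only [Sum.elim_inr]
    rw [integral_add (hw j) ((integrable_indicator_iff measurableSet_Iio).2 h3),
      integral_indicator measurableSet_Iio]

theorem aestronglyMeasurable_R (hY : S.IsFundamental lam Yh) (hZ : S.IsAdjointFundamental lam Zh)
    (hf : S.MemL2 S.A f) (hw : ∀ i, Integrable (fun s => weylSource S lam Zh M f s i) S.dm) :
    AEStronglyMeasurable (S.R lam Yh Zh M f) S.dm :=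
  (aestronglyMeasurable_particular hY hZ hf _).congr
    (S.isSturmian.ae_mem_ray.mono fun _ ht => (R_eq_particular hZ hf hw ht).symm)

theorem continuousOn_W (U : Matrix (Fin n) (Fin n) ℂ) (lam₀ : ℂ) : ContinuousOn (S.W U lam₀) S.T := by
  have h2 := S.continuousOn_A
  have h3 := S.continuousOn_B
  rw [continuousOn_iff_continuous_domRestrict] at *
  have h4 : Continuous (S.T.domRestrict fun t => U2 U * (lam₀ • S.A t + S.B t)) :=
    continuous_const.matrix_mul ((h2.const_smul lam₀).add h3)
  exact Continuous.const_smul (h4.add h4.matrix_conjTranspose) (1 / 2 : ℂ)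

theorem continuousOn_Atilde (U : Matrix (Fin n) (Fin n) ℂ) : ContinuousOn (S.Atilde U) S.T := by
  have h2 := S.continuousOn_A
  rw [continuousOn_iff_continuous_domRestrict] at *
  exact (continuous_const.matrix_mul h2).matrix_mul continuous_const

theorem aemeasurable_ofReal_sesq {G : ℝ → Mat n} (hG : ContinuousOn G S.T) {y : ℝ → Vec n}
    (hy : AEStronglyMeasurable y S.dm) :
    AEMeasurable (fun t => ENNReal.ofReal (sesq (G t) (y t) (y t)).re) S.dm :=
  (Complex.continuous_re.comp_aestronglyMeasurable
    (aestronglyMeasurable_sesq hG hy hy)).aemeasurable.ennreal_ofReal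

/-- The energy estimate for the resolvent. -/
theorem normSq_R_add_le {U : Matrix (Fin n) (Fin n) ℂ} {lam₀ : ℂ} {δ : ℝ}
    (hadm : S.Admissible U lam₀) (hδ : S.LambdaBound U lam₀ lam δ)
    (hY : S.IsFundamental lam Yh) (hZ : S.IsAdjointFundamental lam Zh)
    (hM : M ∈ S.weylLimitSet U Yh) (hf : S.MemL2 S.A f)
    (hw : ∀ i, Integrable (fun s => weylSource S lam Zh M f s i) S.dm)
    {ε : ℝ} (hε : 0 < ε) (hεδ : ε < δ) :
    S.normSq (S.W U lam₀) (S.R lam Yh Zh M f)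
      + ENNReal.ofReal (δ - ε) * S.normSq (S.Atilde U) (S.R lam Yh Zh M f)
      ≤ ENNReal.ofReal (1 / (4 * ε)) * S.normSq S.A f := by
  obtain ⟨t₁, ht₁, hM⟩ := hM
  obtain ⟨k, hk, hkt⟩ := S.isSturmian.exists_seq t₁
  set b : ℕ → Fin n → ℂ := fun j i => ∫ s in Ico S.t₀ (k j), weylSource S lam Zh M f s i ∂S.dm
    with hb
  set Φ : ℕ → ℝ → Vec n := fun j => particular S lam Yh Zh f (b j) with hΦ
  have hblim : Tendsto b atTop (𝓝 fun i => ∫ s, weylSource S lam Zh M f s i ∂S.dm) :=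
    tendsto_pi_nhds.2 fun i =>
      (S.isSturmian.aecover_Ico hkt).integral_tendsto_of_countably_generated (hw i)
  have hΦlim : ∀ t ∈ S.T, Tendsto (fun j => Φ j t) atTop (𝓝 (S.R lam Yh Zh M f t)) := by
    intro t ht
    rw [R_eq_particular hZ hf hw ht]
    exact ((continuous_particular f t).tendsto _).comp hblim
  have hΦm : ∀ j, AEStronglyMeasurable (Φ j) S.dm :=
    fun j => aestronglyMeasurable_particular hY hZ hf _
  have hRm := aestronglyMeasurable_R hY hZ hf hw
  have hcont : ∀ K : Mat n, Continuous fun y : Vec n => ENNReal.ofReal (sesq K y y).re := by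
    intro K
    refine ENNReal.continuous_ofReal.comp (Complex.continuous_re.comp ?_)
    exact continuous_star.dotProduct (continuous_const.matrix_mulVec continuous_id)
  -- The bound on `[t₀, k j)` has a right-hand side independent of `j`, so Fatou's lemma passes it
  -- to the pointwise limit.
  have key := S.isSturmian.lintegral_le_of_forall_Ico hkt
    (g := fun j t => ENNReal.ofReal (sesq (S.W U lam₀ t) (Φ j t) (Φ j t)).re +
      ENNReal.ofReal (δ - ε) * ENNReal.ofReal (sesq (S.Atilde U t) (Φ j t) (Φ j t)).re)
    (G := fun t => ENNReal.ofReal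
        (sesq (S.W U lam₀ t) (S.R lam Yh Zh M f t) (S.R lam Yh Zh M f t)).re +
      ENNReal.ofReal (δ - ε) * ENNReal.ofReal
        (sesq (S.Atilde U t) (S.R lam Yh Zh M f t) (S.R lam Yh Zh M f t)).re)
    (fun j => (aemeasurable_ofReal_sesq (continuousOn_W U lam₀) (hΦm j)).add
      ((aemeasurable_ofReal_sesq (continuousOn_Atilde U) (hΦm j)).const_mul _))
    (fun t ht => (((hcont _).tendsto _).comp (hΦlim t ht)).add
      (ENNReal.Tendsto.const_mul (((hcont _).tendsto _).comp (hΦlim t ht))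
        (Or.inr ENNReal.ofReal_ne_top)))
    (fun j => lintegral_particular_le hadm hδ hY hZ hf (hk j).1 (hM _ (hk j).1 (hk j).2) hε hεδ rfl)
  change ∫⁻ t, _ ∂S.dm ≤ _ at key
  rw [lintegral_add_left' (aemeasurable_ofReal_sesq (continuousOn_W U lam₀) hRm),
    lintegral_const_mul'' _ (aemeasurable_ofReal_sesq (continuousOn_Atilde U) hRm)] at key
  exact key

/-- Drop the `W`-term. The choice `ε = δ/2` minimises `1 / (4 ε (δ - ε))`, with minimum `1 / δ²`. -/
theorem normSq_R_le {U : Matrix (Fin n) (Fin n) ℂ} {lam₀ : ℂ} {δ : ℝ} (hδ0 : 0 < δ)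
    (hadm : S.Admissible U lam₀) (hδ : S.LambdaBound U lam₀ lam δ)
    (hY : S.IsFundamental lam Yh) (hZ : S.IsAdjointFundamental lam Zh)
    (hM : M ∈ S.weylLimitSet U Yh) (hf : S.MemL2 S.A f)
    (hw : ∀ i, Integrable (fun s => weylSource S lam Zh M f s i) S.dm) :
    S.normSq (S.Atilde U) (S.R lam Yh Zh M f) ≤ ENNReal.ofReal (1 / δ ^ 2) * S.normSq S.A f := by
  have h1 := normSq_R_add_le hadm hδ hY hZ hM hf hw (half_pos hδ0) (half_lt_self hδ0)
  have h2 := mul_le_mul_right (le_trans le_add_self h1) (ENNReal.ofReal (2 / δ))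
  rw [← mul_assoc, ← mul_assoc, ← ENNReal.ofReal_mul (by positivity),
    ← ENNReal.ofReal_mul (by positivity)] at h2
  have e1 : 2 / δ * (δ - δ / 2) = 1 := by field_simp; ring
  have e2 : 2 / δ * (1 / (4 * (δ / 2))) = 1 / δ ^ 2 := by field_simp; ring
  rwa [e1, e2, ENNReal.ofReal_one, one_mul] at h2

end Resolvent

theorem normSq_congr {G : ℝ → Mat n} {x y : ℝ → Vec n} (h : ∀ t ∈ S.T, x t = y t) :
    S.normSq G x = S.normSq G y :=
  lintegral_congr_ae (S.isSturmian.ae_mem_ray.mono fun t ht => by simp only [h t ht])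

theorem normSq_zero (G : ℝ → Mat n) : S.normSq G 0 = 0 := by
  simp [normSq]

theorem normSq_A_sub_le {f g : ℝ → Vec n} (hf : S.MemL2 S.A f) (hg : S.MemL2 S.A g) :
    S.normSq S.A (f - g) ≤ 2 * S.normSq S.A f + 2 * S.normSq S.A g := by
  have m1 := aemeasurable_ofReal_sesq S.continuousOn_A hf.1
  have m2 := aemeasurable_ofReal_sesq S.continuousOn_A hg.1
  have h1 : 2 * S.normSq S.A f + 2 * S.normSq S.A g =
      ∫⁻ t, (2 * ENNReal.ofReal (sesq (S.A t) (f t) (f t)).re +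
        2 * ENNReal.ofReal (sesq (S.A t) (g t) (g t)).re) ∂S.dm := by
    rw [lintegral_add_left' (m1.const_mul 2), lintegral_const_mul'' _ m1,
      lintegral_const_mul'' _ m2]
    rfl
  rw [h1]
  refine lintegral_mono_ae ?_
  filter_upwards [S.isSturmian.ae_mem_ray] with t ht
  have hp := S.posSemidef_A' ht
  have e : (2 : ℝ≥0∞) = ENNReal.ofReal 2 := by simp
  rw [e, ← ENNReal.ofReal_mul (by norm_num), ← ENNReal.ofReal_mul (by norm_num),
    ← ENNReal.ofReal_add (mul_nonneg (by norm_num) (hp.re_sesq_nonneg _))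
      (mul_nonneg (by norm_num) (hp.re_sesq_nonneg _))]
  exact ENNReal.ofReal_le_ofReal (hp.re_sesq_sub_le (f t) (g t))

theorem MemL2.sub {f g : ℝ → Vec n} (hf : S.MemL2 S.A f) (hg : S.MemL2 S.A g) :
    S.MemL2 S.A (f - g) := by
  refine ⟨hf.1.sub hg.1, (normSq_A_sub_le hf hg).trans_lt ?_⟩
  exact ENNReal.add_lt_top.2 ⟨ENNReal.mul_lt_top (by simp) hf.2, ENNReal.mul_lt_top (by simp) hg.2⟩

/-- Comparability of weights compares the norms. -/
theorem normSq_le_of_smul_le {F G : ℝ → Mat n} {c : ℝ} (hc : 0 < c)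
    (h : ∀ t ∈ S.T, (F t - (c : ℂ) • G t).PosSemidef) (y : ℝ → Vec n) :
    S.normSq G y ≤ ENNReal.ofReal c⁻¹ * S.normSq F y := by
  rw [normSq, normSq, ← lintegral_const_mul' _ _ ENNReal.ofReal_ne_top]
  refine lintegral_mono_ae ?_
  filter_upwards [S.isSturmian.ae_mem_ray] with t ht
  have h1 := (h t ht).re_sesq_nonneg (y t)
  rw [sesq_sub_matrix, sesq_smul_matrix, Complex.sub_re, Complex.re_ofReal_mul] at h1
  rw [← ENNReal.ofReal_mul (by positivity)]
  refine ENNReal.ofReal_le_ofReal ?_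
  rw [inv_mul_eq_div, le_div_iff₀ hc, mul_comm]
  change c * (sesq (G t) (y t) (y t)).re ≤ (sesq (F t) (y t) (y t)).re
  linarith

theorem R_add_smul {M : Matrix (Fin n) (Fin n) ℂ} (a b : ℂ) {f g : ℝ → Vec n} {t : ℝ}
    (hf : Integrable (fun s => S.green lam Yh Zh M t s *ᵥ (S.A s *ᵥ f s)) S.dm)
    (hg : Integrable (fun s => S.green lam Yh Zh M t s *ᵥ (S.A s *ᵥ g s)) S.dm) :
    S.R lam Yh Zh M (a • f + b • g) t = a • S.R lam Yh Zh M f t + b • S.R lam Yh Zh M g t := by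
  simp only [R, Pi.add_apply, Pi.smul_apply, mulVec_add, mulVec_smul]
  have hf' : Integrable (fun s => a • S.green lam Yh Zh M t s *ᵥ (S.A s *ᵥ f s)) S.dm := hf.smul a
  have hg' : Integrable (fun s => b • S.green lam Yh Zh M t s *ᵥ (S.A s *ᵥ g s)) S.dm := hg.smul b
  rw [integral_add hf' hg', integral_smul, integral_smul, smul_add, smul_add]
  abel

end HamSystem

end

/-! ### The main theorem -/

theorem mainTheorem7 {n : ℕ} (S : HamSystem n)
    (U : Matrix (Fin n) (Fin n) ℂ) (hU : IsUnit U)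
    (lam₀ : ℂ) (hadm : S.Admissible U lam₀)
    (lam : ℂ) (hlam : lam ∈ S.Lambda U lam₀ ∩ S.LambdaTilde U lam₀)
    (Yh Zh : ℝ → Mat n) (hY : S.IsFundamental lam Yh) (hZ : S.IsAdjointFundamental lam Zh)
    (M : Matrix (Fin n) (Fin n) ℂ) (hM : M ∈ S.weylLimitSet U Yh) :
    (∀ f : ℝ → Vec n, S.MemL2 S.A f →
      (∀ t ∈ S.T, Integrable (fun s => S.green lam Yh Zh M t s *ᵥ (S.A s *ᵥ f s)) S.dm) ∧
      S.MemL2 (S.W U lam₀) (S.R lam Yh Zh M f) ∧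
      S.MemL2 (S.Atilde U) (S.R lam Yh Zh M f) ∧
      ∀ δ : ℝ, 0 < δ → S.LambdaBound U lam₀ lam δ →
        (∀ ε : ℝ, 0 < ε → ε < δ →
          S.normSq (S.W U lam₀) (S.R lam Yh Zh M f)
              + ENNReal.ofReal (δ - ε) * S.normSq (S.Atilde U) (S.R lam Yh Zh M f)
            ≤ ENNReal.ofReal (1 / (4 * ε)) * S.normSq S.A f) ∧
        S.normSq (S.Atilde U) (S.R lam Yh Zh M f)
          ≤ ENNReal.ofReal (1 / δ ^ 2) * S.normSq S.A f) ∧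
    (S.Comparable (S.Atilde U) S.A → S.IsBoundedOperator S.A (S.R lam Yh Zh M)) := by
  obtain ⟨⟨δ₀, hδ₀, hδ₀b⟩, -⟩ := hlam
  have hw : ∀ f : ℝ → Vec n, S.MemL2 S.A f → ∀ i,
      Integrable (fun s => HamSystem.weylSource S lam Zh M f s i) S.dm :=
    fun f hf => HamSystem.integrable_weylSource hU hadm hδ₀ hδ₀b hY hZ hM hf
  have hint : ∀ f : ℝ → Vec n, S.MemL2 S.A f → ∀ t ∈ S.T,
      Integrable (fun s => S.green lam Yh Zh M t s *ᵥ (S.A s *ᵥ f s)) S.dm :=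
    fun f hf t ht => (HamSystem.integrable_green hZ hf (hw f hf) ht).2
  have hmeas : ∀ f : ℝ → Vec n, S.MemL2 S.A f →
      AEStronglyMeasurable (S.R lam Yh Zh M f) S.dm :=
    fun f hf => HamSystem.aestronglyMeasurable_R hY hZ hf (hw f hf)
  have hbound : ∀ f : ℝ → Vec n, S.MemL2 S.A f → ∀ δ : ℝ, 0 < δ → S.LambdaBound U lam₀ lam δ →
      S.normSq (S.Atilde U) (S.R lam Yh Zh M f) ≤ ENNReal.ofReal (1 / δ ^ 2) * S.normSq S.A f :=
    fun f hf δ hδ0 hδ => HamSystem.normSq_R_le hδ0 hadm hδ hY hZ hM hf (hw f hf)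
  refine ⟨fun f hf => ⟨hint f hf, ⟨hmeas f hf, ?_⟩, ⟨hmeas f hf, ?_⟩, fun δ hδ0 hδ =>
    ⟨fun ε hε hεδ => HamSystem.normSq_R_add_le hadm hδ hY hZ hM hf (hw f hf) hε hεδ,
      hbound f hf δ hδ0 hδ⟩⟩, fun hcomp => ?_⟩
  · have h1 := HamSystem.normSq_R_add_le hadm hδ₀b hY hZ hM hf (hw f hf) (half_pos hδ₀)
      (half_lt_self hδ₀)
    exact (le_self_add.trans h1).trans_lt (ENNReal.mul_lt_top ENNReal.ofReal_lt_top hf.2)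
  · exact (hbound f hf δ₀ hδ₀ hδ₀b).trans_lt (ENNReal.mul_lt_top ENNReal.ofReal_lt_top hf.2)
  obtain ⟨c, C, hc, -, hcC⟩ := hcomp
  have hbA : ∀ f : ℝ → Vec n, S.MemL2 S.A f → S.normSq S.A (S.R lam Yh Zh M f) ≤
      ((Real.sqrt (c⁻¹ * (1 / δ₀ ^ 2))).toNNReal : ℝ≥0∞) ^ 2 * S.normSq S.A f := by
    intro f hf
    -- The operator bound is `c^(-1/2) / δ₀`: the lower comparison `c A ≤ Ã` converts the
    -- `Ã`-estimate into an `A`-estimate.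
    have h1 : ((Real.sqrt (c⁻¹ * (1 / δ₀ ^ 2))).toNNReal : ℝ≥0∞) ^ 2 =
        ENNReal.ofReal c⁻¹ * ENNReal.ofReal (1 / δ₀ ^ 2) := by
      rw [← ENNReal.ofReal_mul (by positivity)]
      change ENNReal.ofReal _ ^ 2 = _
      rw [← ENNReal.ofReal_pow (Real.sqrt_nonneg _), Real.sq_sqrt (by positivity)]
    rw [h1, mul_assoc]
    exact (HamSystem.normSq_le_of_smul_le hc (fun t ht => (hcC t ht).1) _).trans
      (mul_le_mul_right (hbound f hf δ₀ hδ₀ hδ₀b) _)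
  have hlin : ∀ (a b : ℂ) (f g : ℝ → Vec n), S.MemL2 S.A f → S.MemL2 S.A g → ∀ t ∈ S.T,
      S.R lam Yh Zh M (a • f + b • g) t = a • S.R lam Yh Zh M f t + b • S.R lam Yh Zh M g t :=
    fun a b f g hf hg t ht => HamSystem.R_add_smul a b (hint f hf t ht) (hint g hg t ht)
  refine ⟨fun f hf => ⟨hmeas f hf, (hbA f hf).trans_lt
    (ENNReal.mul_lt_top (by simp) hf.2)⟩, fun f g hf hg hfg => ?_, fun a b f g hf hg => ?_, _, hbA⟩
  -- Compatibility with equality in `L²_A` follows from linearity and the norm bound applied to `f -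
  -- g`.
  · have h1 : S.normSq S.A (S.R lam Yh Zh M f - S.R lam Yh Zh M g) =
        S.normSq S.A (S.R lam Yh Zh M (f - g)) := by
      refine HamSystem.normSq_congr fun t ht => ?_
      have h2 := hlin 1 (-1) f g hf hg t ht
      rw [one_smul, neg_one_smul, ← sub_eq_add_neg, one_smul, neg_one_smul,
        ← sub_eq_add_neg] at h2
      rw [h2]; rfl
    rw [h1]
    refine le_antisymm ((hbA _ (hf.sub hg)).trans ?_) zero_le
    rw [hfg, mul_zero]
  · rw [HamSystem.normSq_congr (y := 0), HamSystem.normSq_zero]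
    intro t ht
    have h2 := hlin a b f g hf hg t ht
    rw [Pi.sub_apply, h2]
    exact sub_self _
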